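/- Notation. For a Gaussian prime $\pi\nmid 2$ and $\alpha\in\mathbb Z[i]$ let $\left(\frac{\alpha}{\pi}\right)_4=0$ if $\pi\mid\alpha$, and otherwise let $\left(\frac{\alpha}{\pi}\right)_4$ be the unique element of $\{1,i,-1,-i\}$ congruent to $\alpha^{(N(\pi)-1)/4}$ modulo $\pi$, where $N(\pi)=\pi\bar\pi$. For $\beta\in\mathbb Z[i]$ prime to $2$ with prime factorization $\beta=\varepsilon\pi_1\cdots\pi_s$ ($\varepsilon$ a unit), the quartic Jacobi symbol is $\left(\frac{\alpha}{\beta}\right)_4=\prod_{j=1}^s\left(\frac{\alpha}{\pi_j}\right)_4$; for integers $u,v$ with $v$ prime to $\beta$ put $\left(\frac{u/v}{\beta}\right)_4=\left(\frac{u}{\beta}\right)_4\left(\frac{v}{\beta}\right)_4^{-1}$. Theorem 4.7. Let $p\equiv 1\pmod 8$ be a prime, and let $p=c^2+d^2=x^2+2(a^2+b^2)y^2$ with $a,b,c,d,x,y\in\mathbb Z$, $a\ne 0$, $2\mid a$, $(a,b)=1$, $c\equiv 1\pmod 4$, $d=2^rd_0$ with $r\ge 0$ and $d_0\equiv 1\pmod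 4$. Assume that $(c,x+d)=1$ or $(d_0,x+c)=1$, where $(m,n)$ denotes the greatest common divisor. Then for every $m\in\mathbb Z$, $$(-a^2-b^2)^{\frac{p-1}8}\equiv\begin{cases}(-1)^{\frac d4+\frac y2}\left(\frac cd\right)^m\pmod p&\text{if }4\mid a,\\[2pt](-1)^{\frac{b-1}2+\frac d4+\frac y2+\frac{x-1}2}\left(\frac cd\right)^{m-1}\pmod p&\text{if }4\mid a-2\end{cases}$$ if and only if $$\left(\frac{(ac+bd)/x}{b+ai}\right)_4=i^m.$$ Here $\frac cd$ is the quotient of $c$ by $d$ modulo $p$ (the hypotheses imply $p\nmid cd$, $4\mid d$, $2\mid y$, $2\nmid bx$ and that $x$ is prime to $a^2+b^2$). -/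

import Mathlib

/-- The quartic residue symbol `(α/π)₄` for a Gaussian prime `π` not dividing `2`:
it is `0` if `π ∣ α`, and otherwise it is the unique power `i ^ k` (`k = 0, 1, 2, 3`) with
`α ^ ((N π - 1) / 4) ≡ i ^ k (mod π)`.
(The last alternative is never reached for a prime `π` not dividing `2`.) -/
noncomputable def quarticResidueSymbol (α π : GaussianInt) : ℂ :=
  open Classical in
  if π ∣ α then 0
  else if π ∣ α ^ ((π.norm.natAbs - 1) / 4) - 1 then 1
  else if π ∣ α ^ ((π.norm.natAbs - 1) / 4) - ⟨0, 1⟩ then Complex.I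
  else if π ∣ α ^ ((π.norm.natAbs - 1) / 4) + 1 then -1
  else if π ∣ α ^ ((π.norm.natAbs - 1) / 4) + ⟨0, 1⟩ then -Complex.I
  else 0

/-- The quartic Jacobi symbol `(α/β)₄` for a nonzero Gaussian integer `β` prime to `2`:
the product of the quartic residue symbols `(α/π)₄` over the prime factors `π` of `β`, counted
with multiplicity. A prime factor may be replaced by an associate without changing the symbol,
so it does not matter whether primary primes are used; for a unit `β` the symbol is `1`. -/
noncomputable def quarticJacobiSymbol (α β : GaussianInt) : ℂ :=
  ((UniqueFactorizationMonoid.factors β).map fun π => quarticResidueSymbol α π).prod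

/-- The quartic Jacobi symbol `(t/β)₄` of a rational number `t` whose denominator is prime to `β`,
extended multiplicatively: `(u/v / β)₄ = (u/β)₄ (v/β)₄⁻¹`, here with `u/v` the reduced form
of `t`. -/
noncomputable def quarticJacobiSymbolRat (t : ℚ) (β : GaussianInt) : ℂ :=
  quarticJacobiSymbol (t.num : GaussianInt) β / quarticJacobiSymbol (t.den : GaussianInt) β

/-!
Write `β = b + a i`, `Q = N(β)` and `ϖ = c + d i`, so that `p = N(ϖ) = x² + 2 Q y²` is congruent to
`x²` modulo `β`. Modulo `β` the resolvent `ρ = s x + s̄ i ϖ` of Hilbert's Theorem 90 satisfies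
`x ρ ≡ i ϖ ρ̄`, which gives `(i ϖ / β)₄ = (x / β)₄ (ρ / Q)₄`. Writing `ρ = (1 + i) γ`, quartic
reciprocity with a rational argument, a consequence of the factorization of Jacobi sums, turns
`(γ / Q)₄` into `(Q / γ)₄`. Now `N(γ) = x h + N(s) Q y²`, where `h` is the trace `Re (s̄ ρ)`, so
that `(Q / γ)₄` reduces to the symbols of the integers `x`, `y`, `h`, `N(s)` modulo `γ`, which
reciprocity and the supplementary laws evaluate. The twist `s ≡ 1 (mod 8)` is chosen so that `h` is
prime to `Q y p`.

The result links `(ϖ / β)₄ / (x / β)₄`, hence the symbol of `(a c + b d) / x`, with symbols modulo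
`ϖ`. On the other side, `-Q = w (x / ((1 + w) y))²` in `ZMod p`, where `w = ± c / d` is a square
root of `-1`, so that `(-Q) ^ ((p - 1) / 8)` is a product of quartic symbols modulo `ϖ` as well.
-/

namespace QuarticSymbol

open Complex (I)

local notation "𝒊" => (Zsqrtd.sqrtd : GaussianInt)
local notation "Jac" => quarticJacobiSymbol

section ResidueSymbol

variable {π α α' β : GaussianInt}

theorem sqrtd_sq : 𝒊 ^ 2 = -1 := by rw [sq, Zsqrtd.dmuld]; norm_num

theorem sqrtd_pow_four : 𝒊 ^ 4 = 1 := by linear_combination (𝒊 ^ 2 - 1) * sqrtd_sq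

theorem norm_eq_sq_add_sq (α : GaussianInt) : α.norm = α.re ^ 2 + α.im ^ 2 := by
  rw [Zsqrtd.norm_def]; ring

theorem eq_re_add_im_mul_sqrtd (α : GaussianInt) : α = α.re + α.im * 𝒊 := by
  ext <;> simp [Zsqrtd.sqrtd]

theorem toComplex_sqrtd : GaussianInt.toComplex 𝒊 = I := by
  simp [Zsqrtd.sqrtd, GaussianInt.toComplex_def]

theorem I_pow_eq_iff {k l : ℕ} : I ^ k = I ^ l ↔ 𝒊 ^ k = 𝒊 ^ l := by
  rw [← toComplex_sqrtd, ← map_pow, ← map_pow, GaussianInt.toComplex_inj]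

theorem I_pow_four_mul (n : ℕ) : I ^ (4 * n) = 1 := by rw [pow_mul, Complex.I_pow_four, one_pow]

theorem ne_zero_of_odd_norm (h : Odd β.norm) : β ≠ 0 := by
  rintro rfl; simp at h

theorem odd_norm_mul : Odd (α * β).norm ↔ Odd α.norm ∧ Odd β.norm := by
  rw [Zsqrtd.norm_mul, Int.odd_mul]

theorem norm_dvd_norm (h : α ∣ β) : α.norm ∣ β.norm := map_dvd Zsqrtd.normMonoidHom h

theorem star_dvd_star : star α ∣ star β ↔ α ∣ β :=
  map_dvd_iff (starRingAut (R := GaussianInt))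

theorem prime_star (hπ : Prime π) : Prime (star π) :=
  (MulEquiv.prime_iff (starRingAut (R := GaussianInt))).2 hπ

theorem norm_emod_four (h : Odd β.norm) : β.norm % 4 = 1 := by
  rw [norm_eq_sq_add_sq, Int.odd_iff] at *
  have sq_emod_four (u : ℤ) : u ^ 2 % 4 = 0 ∨ u ^ 2 % 4 = 1 := by
    rcases Int.even_or_odd u with hu | hu
    · exact .inl (Int.emod_eq_zero_of_dvd (pow_dvd_pow_of_dvd hu.two_dvd 2))
    · exact .inr (Int.sq_mod_four_eq_one_of_odd hu)
  have := sq_emod_four β.re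
  have := sq_emod_four β.im
  omega

theorem four_dvd_natAbs_norm_sub_one (h : Odd β.norm) : 4 ∣ β.norm.natAbs - 1 := by
  have := norm_emod_four h
  have := GaussianInt.norm_nonneg β
  omega

theorem isUnit_of_odd_norm_of_norm_dvd_four (ho : Odd π.norm) (h : π.norm ∣ 4) : IsUnit π := by
  rw [← Zsqrtd.norm_eq_one_iff]
  have := norm_emod_four ho
  have := GaussianInt.norm_nonneg π
  have := Int.le_of_dvd (by norm_num) h
  omega

theorem I_pow_eq_of_dvd_sqrtd_pow_sub (hπ : Prime π) (ho : Odd π.norm) {k l : ℕ}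
    (h : π ∣ 𝒊 ^ k - 𝒊 ^ l) : I ^ k = I ^ l := by
  rw [I_pow_eq_iff]
  rw [pow_eq_pow_mod k sqrtd_pow_four, pow_eq_pow_mod l sqrtd_pow_four] at h ⊢
  by_contra hne
  refine hπ.not_isUnit (isUnit_of_odd_norm_of_norm_dvd_four ho ((norm_dvd_norm h).trans ?_))
  have hk : k % 4 < 4 := Nat.mod_lt _ (by norm_num)
  have hl : l % 4 < 4 := Nat.mod_lt _ (by norm_num)
  generalize k % 4 = k at *
  generalize l % 4 = l at *
  interval_cases k <;> interval_cases l <;> first | exact absurd rfl hne | decide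

theorem prime_of_norm_eq_prime {p : ℕ} (hp : p.Prime) (h : π.norm = p) : Prime π := by
  have isUnit_iff (α : GaussianInt) : IsUnit α ↔ IsUnit α.norm := by
    rw [← Zsqrtd.norm_eq_one_iff, Int.isUnit_iff_natAbs_eq]
  have hp' : Irreducible π.norm := h ▸ (Nat.prime_iff_prime_int.1 hp).irreducible
  refine irreducible_iff_prime.1 ⟨fun hu => hp'.not_isUnit ((isUnit_iff π).1 hu), ?_⟩
  rintro a b rfl
  rw [isUnit_iff, isUnit_iff]
  exact hp'.isUnit_or_isUnit (Zsqrtd.norm_mul a b)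

theorem exists_prime_dvd_natCast (hπ : Prime π) : ∃ q : ℕ, q.Prime ∧ π ∣ (q : GaussianInt) := by
  have h0 : π.norm.natAbs ≠ 0 := by
    rw [Int.natAbs_ne_zero]
    exact fun h => hπ.ne_zero ((Zsqrtd.norm_eq_zero_iff (by norm_num) π).1 h)
  have h1 : π ∣ ((π.norm.natAbs : ℕ) : GaussianInt) := by
    rw [GaussianInt.natCast_natAbs_norm, Zsqrtd.norm_eq_mul_conj]
    exact dvd_mul_right _ _
  rw [← Nat.prod_primeFactorsList h0, Nat.cast_list_prod, hπ.dvd_prod_iff] at h1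
  obtain ⟨_, hx, hd⟩ := h1
  obtain ⟨q, hq, rfl⟩ := List.mem_map.1 hx
  exact ⟨q, Nat.prime_of_mem_primeFactorsList hq, hd⟩

theorem split_or_inert (hπ : Prime π) :
    (∃ p : ℕ, p.Prime ∧ π.norm = p) ∨
      ∃ q : ℕ, q.Prime ∧ q % 4 = 3 ∧ Associated π (q : GaussianInt) := by
  obtain ⟨q, hq, w, hw⟩ := exists_prime_dvd_natCast hπ
  have hqq : q ^ 2 = π.norm.natAbs * w.norm.natAbs := by
    rw [← Int.natAbs_mul, ← Zsqrtd.norm_mul, ← hw, Zsqrtd.norm_natCast, Int.natAbs_mul, sq]; simp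
  obtain ⟨k, hk, hπk⟩ := (Nat.dvd_prime_pow hq).1 (Dvd.intro _ hqq.symm)
  interval_cases k
  · exact absurd (Zsqrtd.norm_eq_one_iff.1 (by simpa using hπk)) hπ.not_isUnit
  · have := GaussianInt.norm_nonneg π
    exact .inl ⟨q, hq, by rw [pow_one] at hπk; omega⟩
  · have hw1 : IsUnit w := by
      rw [hπk] at hqq
      exact Zsqrtd.norm_eq_one_iff.1 (by simpa [hq.ne_zero] using hqq.symm)
    have ha : Associated π (q : GaussianInt) := ⟨hw1.unit, hw.symm⟩
    have := Fact.mk hq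
    exact .inr ⟨q, hq, (GaussianInt.prime_iff_mod_four_eq_three_of_nat_prime q).1
      (ha.prime_iff.1 hπ), ha⟩

theorem map_eq_zero_iff_dvd {R : Type*} [CommRing R] [Nontrivial R] (f : GaussianInt →+* R)
    (hπ : Prime π) (hf : f π = 0) : f α = 0 ↔ π ∣ α := by
  refine ⟨fun h => ?_, fun ⟨w, hw⟩ => by rw [hw, map_mul, hf, zero_mul]⟩
  by_contra hd
  obtain ⟨a, b, hab⟩ := (irreducible_iff_prime.2 hπ).coprime_iff_not_dvd.2 hd
  simpa [hf, h] using congrArg f hab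

theorem exists_hom_zmod {p : ℕ} [Fact p.Prime] (h : π.norm = p) :
    ∃ f : GaussianInt →+* ZMod p, f π = 0 := by
  have hp : p.Prime := Fact.out
  have hsum : (π.re : ZMod p) ^ 2 + (π.im : ZMod p) ^ 2 = 0 := by
    rw [norm_eq_sq_add_sq] at h
    simpa using congrArg (Int.cast : ℤ → ZMod p) h
  have him : (π.im : ZMod p) ≠ 0 := by
    intro him
    have hre : (π.re : ZMod p) = 0 := by simpa [him] using hsum
    rw [ZMod.intCast_zmod_eq_zero_iff_dvd] at him hre
    have hpπ : ((p : ℤ) : GaussianInt) ∣ π := (Zsqrtd.intCast_dvd _ _).2 ⟨hre, him⟩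
    have hpp := norm_dvd_norm hpπ
    rw [Zsqrtd.norm_intCast, h] at hpp
    have hle : p * p ≤ p := Nat.le_of_dvd hp.pos (by exact_mod_cast hpp)
    exact hp.one_lt.not_ge (Nat.le_of_mul_le_mul_left (by simpa using hle) hp.pos)
  refine ⟨Zsqrtd.lift ⟨-(π.re : ZMod p) / π.im, ?_⟩, ?_⟩
  · push_cast; field_simp; linear_combination hsum
  · rw [Zsqrtd.lift_apply_apply]; field_simp; ring

theorem natCast_dvd_pow_sub_star {q : ℕ} (hq : q.Prime) (hq3 : q % 4 = 3) (α : GaussianInt) :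
    (q : GaussianInt) ∣ α ^ q - star α := by
  have := Fact.mk hq
  have fermat (z : ℤ) : (q : GaussianInt) ∣ (z : GaussianInt) ^ q - z := by
    have h : (q : ℤ) ∣ z ^ q - z := by
      rw [← ZMod.intCast_zmod_eq_zero_iff_dvd]; push_cast; rw [ZMod.pow_card, sub_self]
    exact_mod_cast (Int.cast_dvd_cast (α := GaussianInt) _ _ h)
  obtain ⟨r, hr⟩ := exists_add_pow_prime_eq hq (α.re : GaussianInt) (α.im * 𝒊)
  obtain ⟨u, hu⟩ := fermat α.re
  obtain ⟨v, hv⟩ := fermat α.im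
  have hi : 𝒊 ^ q = -𝒊 := by
    rw [pow_eq_pow_mod q sqrtd_pow_four, hq3, pow_succ, sqrtd_sq, neg_one_mul]
  have hstar : star α = α.re - α.im * 𝒊 := by ext <;> simp [Zsqrtd.sqrtd]
  have hpow : α ^ q = (α.re + α.im * 𝒊) ^ q := congrArg (· ^ q) (eq_re_add_im_mul_sqrtd α)
  rw [mul_pow, hi] at hr
  exact ⟨u - 𝒊 * v + α.re * (α.im * 𝒊) * r, by
    rw [hpow, hr, hstar]; linear_combination hu - 𝒊 * hv⟩

theorem dvd_pow_natAbs_norm_sub_one (hπ : Prime π) (h : ¬ π ∣ α) :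
    π ∣ α ^ (π.norm.natAbs - 1) - 1 := by
  rcases split_or_inert hπ with ⟨p, hp, hN⟩ | ⟨q, hq, hq3, ha⟩
  · have := Fact.mk hp
    obtain ⟨f, hf⟩ := exists_hom_zmod hN
    rw [← map_eq_zero_iff_dvd f hπ hf] at h ⊢
    rw [hN, Int.natAbs_natCast, map_sub, map_pow, map_one, ZMod.pow_card_sub_one_eq_one h, sub_self]
  · have hN : π.norm.natAbs = q * q := by
      rw [Zsqrtd.norm_eq_of_associated (by norm_num) ha, Zsqrtd.norm_natCast]
      norm_cast
    have hfrob : (q : GaussianInt) ∣ α ^ (q * q) - α := by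
      have := dvd_add ((natCast_dvd_pow_sub_star hq hq3 α).trans
        (sub_dvd_pow_sub_pow (α ^ q) (star α) q)) (natCast_dvd_pow_sub_star hq hq3 (star α))
      rwa [← pow_mul, star_star, sub_add_sub_cancel] at this
    have hfactor : α ^ (q * q) - α = α * (α ^ (q * q - 1) - 1) := by
      rw [mul_sub_one, ← pow_succ', Nat.sub_add_cancel (Nat.mul_pos hq.pos hq.pos)]
    rw [hN]
    exact (hπ.dvd_or_dvd (hfactor ▸ ha.dvd.trans hfrob)).resolve_left h

theorem exists_dvd_pow_sub_sqrtd_pow (hπ : Prime π) (ho : Odd π.norm) (h : ¬ π ∣ α) :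
    ∃ k, π ∣ α ^ ((π.norm.natAbs - 1) / 4) - 𝒊 ^ k := by
  have hfermat := dvd_pow_natAbs_norm_sub_one hπ h
  rw [← Nat.div_mul_cancel (four_dvd_natAbs_norm_sub_one ho), pow_mul] at hfermat
  generalize α ^ ((π.norm.natAbs - 1) / 4) = w at *
  have hfactor : w ^ 4 - 1 =
      (w - 𝒊 ^ 0) * (w - 𝒊 ^ 1) * (w - 𝒊 ^ 2) * (w - 𝒊 ^ 3) := by
    rw [pow_succ 𝒊 2, sqrtd_sq]
    linear_combination (w ^ 2 - 1) * sqrtd_sq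
  rw [hfactor] at hfermat
  simp only [hπ.dvd_mul] at hfermat
  rcases hfermat with ((h | h) | h) | h <;> exact ⟨_, h⟩

theorem residueSymbol_of_dvd (h : π ∣ α) : quarticResidueSymbol α π = 0 := by
  rw [quarticResidueSymbol, if_pos h]

theorem residueSymbol_eq_I_pow (hπ : Prime π) (ho : Odd π.norm) (h : ¬ π ∣ α) {k : ℕ}
    (hk : π ∣ α ^ ((π.norm.natAbs - 1) / 4) - 𝒊 ^ k) : quarticResidueSymbol α π = I ^ k := by
  have unique (l : ℕ) (hl : π ∣ α ^ ((π.norm.natAbs - 1) / 4) - 𝒊 ^ l) : I ^ l = I ^ k :=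
    I_pow_eq_of_dvd_sqrtd_pow_sub hπ ho (by simpa using dvd_sub hk hl)
  have hi : (⟨0, 1⟩ : GaussianInt) = 𝒊 := rfl
  have hi3 : 𝒊 ^ 3 = -𝒊 := by rw [pow_succ, sqrtd_sq, neg_one_mul]
  rw [quarticResidueSymbol, if_neg h]
  split_ifs with h0 h1 h2 h3
  · rw [← unique 0 (by simpa using h0), pow_zero]
  · rw [← unique 1 (by simpa [hi] using h1), pow_one]
  · rw [← unique 2 (by simpa [sqrtd_sq] using h2), Complex.I_sq]
  · rw [← unique 3 (by simpa [hi3, hi] using h3), Complex.I_pow_three]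
  · rw [pow_eq_pow_mod k sqrtd_pow_four] at hk
    have hlt : k % 4 < 4 := Nat.mod_lt _ (by norm_num)
    generalize k % 4 = l at *
    interval_cases l
    · exact absurd (by simpa using hk) h0
    · exact absurd (by simpa [hi] using hk) h1
    · exact absurd (by simpa [sqrtd_sq] using hk) h2
    · exact absurd (by simpa [hi3, hi] using hk) h3

theorem exists_residueSymbol_eq_I_pow (hπ : Prime π) (ho : Odd π.norm) (h : ¬ π ∣ α) :
    ∃ k, quarticResidueSymbol α π = I ^ k ∧ π ∣ α ^ ((π.norm.natAbs - 1) / 4) - 𝒊 ^ k := by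
  obtain ⟨k, hk⟩ := exists_dvd_pow_sub_sqrtd_pow hπ ho h
  exact ⟨k, residueSymbol_eq_I_pow hπ ho h hk, hk⟩

theorem residueSymbol_mul (hπ : Prime π) (ho : Odd π.norm) (α α' : GaussianInt) :
    quarticResidueSymbol (α * α') π = quarticResidueSymbol α π * quarticResidueSymbol α' π := by
  by_cases h : π ∣ α
  · rw [residueSymbol_of_dvd h, residueSymbol_of_dvd (h.mul_right _), zero_mul]
  by_cases h' : π ∣ α'
  · rw [residueSymbol_of_dvd h', residueSymbol_of_dvd (h'.mul_left _), mul_zero]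
  obtain ⟨k, hk, hdvd⟩ := exists_residueSymbol_eq_I_pow hπ ho h
  obtain ⟨l, hl, hdvd'⟩ := exists_residueSymbol_eq_I_pow hπ ho h'
  rw [hk, hl, ← pow_add]
  refine residueSymbol_eq_I_pow hπ ho (hπ.not_dvd_mul h h') ?_
  rw [mul_pow, pow_add]
  exact dvd_mul_sub_mul hdvd hdvd'

theorem residueSymbol_congr (hπ : Prime π) (ho : Odd π.norm) (h : π ∣ α - α') :
    quarticResidueSymbol α π = quarticResidueSymbol α' π := by
  by_cases h' : π ∣ α'
  · rw [residueSymbol_of_dvd h', residueSymbol_of_dvd ((dvd_iff_dvd_of_dvd_sub h).2 h')]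
  obtain ⟨l, hl, hdvd⟩ := exists_residueSymbol_eq_I_pow hπ ho h'
  rw [hl]
  refine residueSymbol_eq_I_pow hπ ho (fun h1 => h' ((dvd_iff_dvd_of_dvd_sub h).1 h1)) ?_
  simpa using dvd_add (h.trans (sub_dvd_pow_sub_pow α α' ((π.norm.natAbs - 1) / 4))) hdvd

theorem residueSymbol_of_associated {π' : GaussianInt} (h : Associated π π') (α : GaussianInt) :
    quarticResidueSymbol α π = quarticResidueSymbol α π' := by
  rw [quarticResidueSymbol, quarticResidueSymbol, Zsqrtd.norm_eq_of_associated (by norm_num) h]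
  congr! 1
  · exact h.dvd_iff_dvd_left
  congr! 1
  · exact h.dvd_iff_dvd_left
  congr! 1
  · exact h.dvd_iff_dvd_left
  congr! 1
  · exact h.dvd_iff_dvd_left
  congr! 1
  exact h.dvd_iff_dvd_left

theorem residueSymbol_star (hπ : Prime π) (ho : Odd π.norm) (α : GaussianInt) :
    quarticResidueSymbol (star α) (star π) = star (quarticResidueSymbol α π) := by
  by_cases h : π ∣ α
  · rw [residueSymbol_of_dvd h, residueSymbol_of_dvd (star_dvd_star.2 h), star_zero]
  obtain ⟨k, hk, hdvd⟩ := exists_residueSymbol_eq_I_pow hπ ho h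
  have hstar_i : star 𝒊 = 𝒊 ^ 3 := by
    rw [pow_succ, sqrtd_sq]; ext <;> simp [Zsqrtd.sqrtd]
  rw [hk, residueSymbol_eq_I_pow (k := 3 * k) (prime_star hπ) (by rwa [Zsqrtd.norm_conj])
    (fun h1 => h (star_dvd_star.1 h1))]
  · rw [pow_mul, Complex.I_pow_three, star_pow]; simp
  · rw [Zsqrtd.norm_conj, pow_mul, ← hstar_i, ← star_pow, ← star_pow, ← star_sub]
    exact star_dvd_star.2 hdvd

end ResidueSymbol

/-! ### The quartic Jacobi symbol -/

section JacobiSymbol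

variable {α α' β β' : GaussianInt}

theorem jacobi_one_right (α : GaussianInt) : Jac α 1 = 1 := by
  simp [quarticJacobiSymbol]

theorem jacobi_prime {π : GaussianInt} (hπ : Prime π) (α : GaussianInt) :
    Jac α π = quarticResidueSymbol α π := by
  obtain ⟨π', h, h'⟩ := UniqueFactorizationMonoid.factors_eq_singleton_of_irreducible hπ.irreducible
  rw [quarticJacobiSymbol, h', Multiset.map_singleton, Multiset.prod_singleton,
    residueSymbol_of_associated h]

theorem jacobi_mul_right (h : β ≠ 0) (h' : β' ≠ 0) (α : GaussianInt) :
    Jac α (β * β') = Jac α β * Jac α β' := by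
  have hrel : (UniqueFactorizationMonoid.factors (β * β')).map (quarticResidueSymbol α) =
      (UniqueFactorizationMonoid.factors β + UniqueFactorizationMonoid.factors β').map
        (quarticResidueSymbol α) := by
    rw [← Multiset.rel_eq, Multiset.rel_map]
    exact (UniqueFactorizationMonoid.factors_mul h h').mono
      fun _ _ _ _ hab => residueSymbol_of_associated hab α
  rw [quarticJacobiSymbol, hrel, Multiset.map_add, Multiset.prod_add]
  rfl

theorem jacobi_of_isUnit (h : IsUnit β) (α : GaussianInt) : Jac α β = 1 := by
  rw [quarticJacobiSymbol, UniqueFactorizationMonoid.factors_of_isUnit h]; simp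

theorem jacobi_isUnit_mul_right {u : GaussianInt} (hu : IsUnit u) (h : β ≠ 0) (α : GaussianInt) :
    Jac α (u * β) = Jac α β := by
  rw [jacobi_mul_right hu.ne_zero h, jacobi_of_isUnit hu, one_mul]

theorem jacobi_neg_right (h : β ≠ 0) (α : GaussianInt) : Jac α (-β) = Jac α β := by
  rw [← neg_one_mul, jacobi_isUnit_mul_right isUnit_one.neg h]

theorem odd_norm_induction {P : ∀ β : GaussianInt, Odd β.norm → Prop}
    (unit : ∀ u h, IsUnit u → P u h)
    (mul : ∀ π β (_ : Prime π) (_ : Odd π.norm) (ho : Odd β.norm) (h : Odd (π * β).norm),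
      P β ho → P (π * β) h) (β : GaussianInt) (h : Odd β.norm) : P β h := by
  induction β using UniqueFactorizationMonoid.induction_on_prime with
  | h₁ => exact absurd rfl (ne_zero_of_odd_norm h)
  | h₂ u hu => exact unit u h hu
  | h₃ β π _ hπ ih =>
    obtain ⟨hπo, hβo⟩ := odd_norm_mul.1 h
    exact mul π β hπ hπo hβo h (ih hβo)

theorem jacobi_mul_left (h : Odd β.norm) (α α' : GaussianInt) :
    Jac (α * α') β = Jac α β * Jac α' β := by
  induction β, h using odd_norm_induction with
  | unit _ _ hu => simp [jacobi_of_isUnit hu]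
  | mul π β hπ ho ho' h ih =>
    simp only [jacobi_mul_right hπ.ne_zero (ne_zero_of_odd_norm ho'), jacobi_prime hπ,
      residueSymbol_mul hπ ho, ih]
    ring

theorem jacobi_congr (h : Odd β.norm) (hd : β ∣ α - α') : Jac α β = Jac α' β := by
  induction β, h using odd_norm_induction with
  | unit _ _ hu => simp [jacobi_of_isUnit hu]
  | mul π β hπ ho ho' _ ih =>
    rw [jacobi_mul_right hπ.ne_zero (ne_zero_of_odd_norm ho'),
      jacobi_mul_right hπ.ne_zero (ne_zero_of_odd_norm ho'), jacobi_prime hπ, jacobi_prime hπ,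
      residueSymbol_congr hπ ho (dvd_of_mul_right_dvd hd), ih (dvd_of_mul_left_dvd hd)]

theorem exists_jacobi_eq_I_pow (h : Odd β.norm) (hc : IsCoprime α β) :
    ∃ k : ℕ, Jac α β = I ^ k := by
  induction β, h using odd_norm_induction with
  | unit _ _ hu => exact ⟨0, by simp [jacobi_of_isUnit hu]⟩
  | mul π β hπ ho ho' _ ih =>
    obtain ⟨k, hk⟩ := ih hc.of_mul_right_right
    have hnd : ¬ π ∣ α := fun hd => hπ.not_isUnit (hc.of_mul_right_left.isUnit_of_dvd' hd dvd_rfl)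
    obtain ⟨l, hl, -⟩ := exists_residueSymbol_eq_I_pow hπ ho hnd
    exact ⟨l + k, by rw [jacobi_mul_right hπ.ne_zero (ne_zero_of_odd_norm ho'), jacobi_prime hπ, hk,
      hl, pow_add]⟩

theorem jacobi_pow_four (h : Odd β.norm) (hc : IsCoprime α β) : Jac α β ^ 4 = 1 := by
  obtain ⟨k, hk⟩ := exists_jacobi_eq_I_pow h hc
  rw [hk, ← pow_mul, mul_comm, I_pow_four_mul]

theorem jacobi_ne_zero (h : Odd β.norm) (hc : IsCoprime α β) : Jac α β ≠ 0 := by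
  obtain ⟨k, hk⟩ := exists_jacobi_eq_I_pow h hc
  exact hk ▸ pow_ne_zero k Complex.I_ne_zero

theorem jacobi_one_left (h : Odd β.norm) : Jac 1 β = 1 := by
  have hne : Jac 1 β ≠ 0 := jacobi_ne_zero h isCoprime_one_left
  have hsq := jacobi_mul_left h 1 1
  rwa [mul_one, left_eq_mul₀ hne] at hsq

theorem jacobi_pow_left (h : Odd β.norm) (α : GaussianInt) (k : ℕ) :
    Jac (α ^ k) β = Jac α β ^ k := by
  induction k with
  | zero => simpa using jacobi_one_left h
  | succ k ih => rw [pow_succ, jacobi_mul_left h, ih, pow_succ]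

theorem jacobi_mul_star_self (h : Odd β.norm) (hc : IsCoprime α β) :
    Jac α β * star (Jac α β) = 1 := by
  obtain ⟨k, hk⟩ := exists_jacobi_eq_I_pow h hc
  rw [hk, star_pow, ← mul_pow]
  simp

theorem jacobi_star (h : Odd β.norm) (α : GaussianInt) :
    Jac (star α) (star β) = star (Jac α β) := by
  induction β, h using odd_norm_induction with
  | unit u h hu =>
    rw [jacobi_of_isUnit hu, star_one]
    exact jacobi_of_isUnit (hu.map (starRingEnd GaussianInt)) _
  | mul π β hπ ho ho' _ ih =>
    have h0 := (prime_star hπ).ne_zero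
    have h1 : star β ≠ 0 := by simpa using ne_zero_of_odd_norm ho'
    rw [star_mul', jacobi_mul_right h0 h1,
      jacobi_mul_right hπ.ne_zero (ne_zero_of_odd_norm ho'), jacobi_prime hπ,
      jacobi_prime (prime_star hπ), residueSymbol_star hπ ho, ih, star_mul']

theorem I_zpow_four_mul (n : ℤ) : I ^ (4 * n) = 1 := by
  rw [zpow_mul, show I ^ (4 : ℤ) = 1 from Complex.I_pow_four, one_zpow]

theorem I_zpow_eq_of_modEq {m n : ℤ} (h : m ≡ n [ZMOD 4]) : I ^ m = I ^ n := by
  obtain ⟨k, hk⟩ := h.dvd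
  rw [eq_add_of_sub_eq' hk, zpow_add₀ Complex.I_ne_zero, I_zpow_four_mul, mul_one]

theorem isUnit_sqrtd : IsUnit 𝒊 := .of_mul_eq_one (-𝒊) (by linear_combination -sqrtd_sq)

theorem not_dvd_sqrtd {π : GaussianInt} (hπ : Prime π) : ¬ π ∣ 𝒊 := fun hd =>
  hπ.not_isUnit (isUnit_of_dvd_unit hd isUnit_sqrtd)

theorem jacobi_sqrtd {e : ℤ} (he : β.norm = 4 * e + 1) : Jac 𝒊 β = I ^ e := by
  have h : Odd β.norm := ⟨2 * e, by omega⟩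
  induction β, h using odd_norm_induction generalizing e with
  | unit u _ hu =>
    rw [← Zsqrtd.norm_eq_one_iff' (by norm_num)] at hu
    rw [jacobi_of_isUnit ((Zsqrtd.norm_eq_one_iff' (by norm_num) u).1 hu), show e = 0 by omega,
      zpow_zero]
  | mul π β hπ ho ho' _ ih =>
    have hπ4 := norm_emod_four ho
    have hβ4 := norm_emod_four ho'
    have hπ0 := GaussianInt.norm_nonneg π
    obtain ⟨u, hu⟩ : ∃ u, β.norm = 4 * u + 1 := ⟨β.norm / 4, by omega⟩
    obtain ⟨v, hv⟩ : ∃ v : ℕ, π.norm = 4 * v + 1 := ⟨(π.norm / 4).toNat, by omega⟩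
    have hres : quarticResidueSymbol 𝒊 π = I ^ v := by
      apply residueSymbol_eq_I_pow hπ ho (not_dvd_sqrtd hπ)
      rw [show (π.norm.natAbs - 1) / 4 = v by omega, sub_self]
      exact dvd_zero _
    rw [jacobi_mul_right hπ.ne_zero (ne_zero_of_odd_norm ho'), jacobi_prime hπ, hres, ih hu,
      ← zpow_natCast, ← zpow_add₀ Complex.I_ne_zero]
    rw [Zsqrtd.norm_mul, hu, hv] at he
    exact I_zpow_eq_of_modEq (Int.modEq_iff_dvd.2 ⟨v * u, by linarith⟩)

theorem jacobi_neg_one {e : ℤ} (he : β.norm = 4 * e + 1) : Jac (-1) β = (-1) ^ e := by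
  rw [← sqrtd_sq, sq, jacobi_mul_left ⟨2 * e, by omega⟩, jacobi_sqrtd he, ← mul_zpow,
    Complex.I_mul_I]

theorem int_odd_induction {P : ∀ n : ℤ, Odd n → Prop} (one : P 1 odd_one)
    (neg : ∀ n (h : Odd n), P n h → P (-n) h.neg)
    (mul : ∀ (q : ℕ) (n : ℤ) (_ : q.Prime) (hq : Odd (q : ℤ)) (hn : Odd n),
      P n hn → P (q * n) (hq.mul hn)) (n : ℤ) (h : Odd n) : P n h := by
  have natCast (m : ℕ) (h : Odd (m : ℤ)) : P m h := by
    induction m using induction_on_primes with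
    | zero => simp at h
    | one => exact one
    | prime_mul q m hq ih =>
      obtain ⟨hqo, hmo⟩ := Int.odd_mul.1 (by simpa using h)
      convert mul q m hq hqo hmo (ih hmo) using 1
      push_cast; rfl
  obtain ⟨m, rfl | rfl⟩ := n.eq_nat_or_neg
  · exact natCast m h
  · exact neg _ (by simpa using h) (natCast m (by simpa using h))

theorem odd_norm_intCast {n : ℤ} (h : Odd n) : Odd (n : GaussianInt).norm := by
  rw [Zsqrtd.norm_intCast]; exact h.mul h

theorem odd_norm_natCast {n : ℕ} (h : Odd (n : ℤ)) : Odd (n : GaussianInt).norm :=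
  odd_norm_intCast h

theorem intCast_ne_zero_of_odd {n : ℤ} (h : Odd n) : (n : GaussianInt) ≠ 0 :=
  ne_zero_of_odd_norm (odd_norm_intCast h)

theorem dvd_norm (α : GaussianInt) : α ∣ (α.norm : GaussianInt) := by
  rw [Zsqrtd.norm_eq_mul_conj]; exact dvd_mul_right _ _

theorem star_intCast (n : ℤ) : star (n : GaussianInt) = n := by ext <;> simp

theorem isCoprime_one_add_sqrtd (h : Odd β.norm) : IsCoprime (1 + 𝒊) β := by
  obtain ⟨k, hk⟩ := h
  have h2 := Zsqrtd.norm_eq_mul_conj β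
  rw [hk] at h2
  push_cast at h2
  exact ⟨-(1 - 𝒊) * k, star β, by linear_combination (k : GaussianInt) * sqrtd_sq - h2⟩

theorem isCoprime_two (h : Odd β.norm) : IsCoprime 2 β := by
  have h2 := (isCoprime_one_add_sqrtd h).mul_left (isCoprime_one_add_sqrtd h)
  rw [show (1 + 𝒊) * (1 + 𝒊) = 2 * 𝒊 by linear_combination sqrtd_sq] at h2
  exact h2.of_mul_left_left

theorem exists_prime_norm_eq {q : ℕ} (hq : q.Prime) (h : q % 4 = 1) :
    ∃ κ : GaussianInt, Prime κ ∧ κ.norm = q := by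
  have := Fact.mk hq
  obtain ⟨a, b, hab⟩ := Nat.Prime.sq_add_sq (p := q) (by omega)
  have hN : (⟨a, b⟩ : GaussianInt).norm = q := by
    rw [norm_eq_sq_add_sq, ← hab]; push_cast; rfl
  exact ⟨_, prime_of_norm_eq_prime hq hN, hN⟩

theorem jacobi_norm_right (h : β ≠ 0) (α : GaussianInt) :
    Jac α β.norm = Jac α β * Jac α (star β) := by
  rw [Zsqrtd.norm_eq_mul_conj, jacobi_mul_right h (by simpa using h)]

-- `star α = 𝒊 ^ j * α` holds for rational `α` with `j = 0`, and for `1 + 𝒊` with `j = 3`.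
theorem jacobi_norm_of_star_eq {j : ℕ} (hα : star α = 𝒊 ^ j * α) (hc : IsCoprime α β) {e : ℤ}
    (he : β.norm = 4 * e + 1) : Jac α β.norm = I ^ (-(j * e)) := by
  have h : Odd β.norm := ⟨2 * e, by omega⟩
  have hpow : Jac (𝒊 ^ j) β = I ^ (j * e) := by
    rw [jacobi_pow_left h, jacobi_sqrtd he, ← zpow_natCast, ← zpow_mul, mul_comm]
  have hstar : Jac α (star β) = star (Jac (𝒊 ^ j * α) β) := by
    rw [← jacobi_star h, ← hα, star_star]
  rw [jacobi_norm_right (ne_zero_of_odd_norm h), hstar, jacobi_mul_left h, hpow, star_mul',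
    mul_left_comm, jacobi_mul_star_self h hc]
  simp [← Complex.inv_I]

theorem natAbs_norm_natCast_sub_one_div_four {q : ℕ} (hq3 : q % 4 = 3) :
    ((q : GaussianInt).norm.natAbs - 1) / 4 = (q - 1) * ((q + 1) / 4) := by
  obtain ⟨k, rfl⟩ : ∃ k, q = 4 * k + 3 := ⟨q / 4, by omega⟩
  rw [Zsqrtd.norm_natCast, Int.natAbs_mul, Int.natAbs_natCast,
    show (4 * k + 3 + 1) / 4 = k + 1 by omega, show 4 * k + 3 - 1 = 4 * k + 2 by omega]
  exact Nat.div_eq_of_eq_mul_right (by norm_num) (Nat.sub_eq_of_eq_add (by ring))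

theorem jacobi_inert_of_star_eq {j : ℕ} (hα : star α = 𝒊 ^ j * α) {q : ℕ} (hq : q.Prime)
    (hq3 : q % 4 = 3) (hc : IsCoprime α q) : Jac α q = I ^ (j * ((q + 1) / 4)) := by
  have := Fact.mk hq
  have hqp := GaussianInt.prime_of_nat_prime_of_mod_four_eq_three q hq3
  have hnd : ¬ (q : GaussianInt) ∣ α := fun hd => hqp.not_isUnit (hc.isUnit_of_dvd' hd dvd_rfl)
  have hpow : (q : GaussianInt) ∣ α ^ (q - 1) - 𝒊 ^ j := by
    have := natCast_dvd_pow_sub_star hq hq3 α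
    rw [hα, ← Nat.sub_add_cancel hq.one_le, pow_succ, Nat.sub_add_cancel hq.one_le, ← sub_mul]
      at this
    exact (hqp.dvd_or_dvd this).resolve_right hnd
  rw [jacobi_prime hqp]
  refine residueSymbol_eq_I_pow hqp (odd_norm_natCast (Int.odd_iff.2 (by omega))) hnd ?_
  rw [natAbs_norm_natCast_sub_one_div_four hq3, pow_mul, pow_mul]
  exact hpow.trans (sub_dvd_pow_sub_pow _ _ _)

theorem exists_jacobi_natCast_prime_of_star_eq {j : ℕ} (hα : star α = 𝒊 ^ j * α) {q : ℕ}
    (hq : q.Prime) (hqo : Odd (q : ℤ)) (hc : IsCoprime α q) :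
    ∃ e : ℤ, ((q : ℤ) = 4 * e + 1 ∨ -(q : ℤ) = 4 * e + 1) ∧ Jac α q = I ^ (-(j * e)) := by
  obtain hq1 | hq3 : q % 4 = 1 ∨ q % 4 = 3 := by rw [Int.odd_iff] at hqo; omega
  · obtain ⟨κ, hκ, hN⟩ := exists_prime_norm_eq hq hq1
    have hqN : (q : GaussianInt) = (κ.norm : GaussianInt) := by rw [hN, Int.cast_natCast]
    rw [hqN] at hc ⊢
    exact ⟨q / 4, by omega, jacobi_norm_of_star_eq hα
      (hc.of_isCoprime_of_dvd_right (dvd_norm κ)) (by omega)⟩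
  · refine ⟨-((q + 1) / 4 : ℕ), by omega, ?_⟩
    rw [jacobi_inert_of_star_eq hα hq hq3 hc, ← zpow_natCast]
    push_cast
    rw [mul_neg, neg_neg]

theorem exists_jacobi_intCast_of_star_eq {j : ℕ} (hα : star α = 𝒊 ^ j * α) {n : ℤ} (hn : Odd n)
    (hc : IsCoprime α n) :
    ∃ e : ℤ, (n = 4 * e + 1 ∨ -n = 4 * e + 1) ∧ Jac α n = I ^ (-(j * e)) := by
  induction n, hn using int_odd_induction with
  | one => exact ⟨0, by simp [jacobi_one_right]⟩
  | neg n hn ih =>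
    push_cast at hc ⊢
    rw [jacobi_neg_right (intCast_ne_zero_of_odd hn), neg_neg]
    simpa only [or_comm] using ih (by rwa [IsCoprime.neg_right_iff] at hc)
  | mul q n hq hqo hn ih =>
    push_cast at hc ⊢
    obtain ⟨e, he, hJ⟩ := ih hc.of_mul_right_right
    obtain ⟨f, hf, hJ'⟩ := exists_jacobi_natCast_prime_of_star_eq hα hq hqo hc.of_mul_right_left
    refine ⟨4 * (e * f) + (e + f), ?_, ?_⟩
    · rcases he with he | he <;> rcases hf with hf | hf
      · left; rw [he, hf]; ring
      · right; rw [← neg_mul, he, hf]; ring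
      · right; rw [← mul_neg, he, hf]; ring
      · left; rw [← neg_mul_neg, he, hf]; ring
    · rw [jacobi_mul_right (ne_zero_of_odd_norm (odd_norm_natCast hqo))
        (intCast_ne_zero_of_odd hn), hJ, hJ', ← zpow_add₀ Complex.I_ne_zero]
      exact I_zpow_eq_of_modEq (Int.modEq_iff_dvd.2 ⟨-(j * (e * f)), by ring⟩)

theorem jacobi_intCast_intCast {n : ℤ} (hn : Odd n) {r : ℤ} (hc : IsCoprime (r : GaussianInt) n) :
    Jac r n = 1 := by
  obtain ⟨e, -, he⟩ := exists_jacobi_intCast_of_star_eq (j := 0) (by simp) hn hc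
  simpa using he

theorem jacobi_one_add_sqrtd_intCast {n e : ℤ} (h : n = 4 * e + 1) : Jac (1 + 𝒊) n = I ^ e := by
  have hn : Odd n := ⟨2 * e, by omega⟩
  obtain ⟨f, hf, hJ⟩ := exists_jacobi_intCast_of_star_eq (α := 1 + 𝒊) (j := 3) (by decide) hn
    (isCoprime_one_add_sqrtd (odd_norm_intCast hn))
  obtain rfl : f = e := by omega
  exact hJ.trans (I_zpow_eq_of_modEq (Int.modEq_iff_dvd.2 ⟨f, by push_cast; ring⟩))

end JacobiSymbol

/-! ### Jacobi sums of quartic characters -/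

section JacobiSum

variable {α β π : GaussianInt}

section GaussSum

variable {p q : ℕ} [Fact p.Prime] [Fact q.Prime] {L : Type*} [Field L]

theorem isQuadratic_sq {χ : MulChar (ZMod p) L} (h4 : χ ^ 4 = 1) : (χ ^ 2).IsQuadratic := by
  intro a
  by_cases ha : IsUnit a
  · have h1 : χ a ^ 4 = 1 := by
      rw [← MulChar.pow_apply' _ (by norm_num), h4, MulChar.one_apply ha]
    rw [MulChar.pow_apply' _ two_ne_zero]
    exact .inr (sq_eq_sq_iff_eq_or_eq_neg.1 (by rw [← pow_mul, one_pow]; exact h1))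
  · exact .inl (MulChar.map_nonunit _ ha)

theorem apply_neg_one_sq (χ : MulChar (ZMod p) L) : χ (-1) ^ 2 = 1 := by
  rw [sq, ← map_mul]; simp

theorem inv_apply_neg_one (χ : MulChar (ZMod p) L) : χ⁻¹ (-1) = χ (-1) := by
  rw [MulChar.inv_apply_eq_inv', inv_eq_of_mul_eq_one_right]
  rw [← sq, apply_neg_one_sq]

theorem gaussSum_pow_four {χ : MulChar (ZMod p) L} (h4 : χ ^ 4 = 1) (h2 : χ ^ 2 ≠ 1)
    {ψ : AddChar (ZMod p) L} (hψ : ψ.IsPrimitive) :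
    gaussSum χ ψ ^ 4 = jacobiSum χ χ ^ 2 * p := by
  have hJ : gaussSum (χ ^ 2) ψ * jacobiSum χ χ = gaussSum χ ψ ^ 2 := by
    simpa only [sq] using jacobiSum_mul_nontrivial (by rwa [← sq]) ψ
  have hsq : gaussSum (χ ^ 2) ψ ^ 2 = p := by
    rw [gaussSum_sq h2 (isQuadratic_sq h4) hψ, MulChar.pow_apply' _ two_ne_zero,
      apply_neg_one_sq, one_mul, ZMod.card]
  rw [show 4 = 2 * 2 from rfl, pow_mul, ← hJ, mul_pow, hsq, mul_comm]

theorem natCast_ne_zero_of_ne [CharP L q] (hpq : p ≠ q) : (p : L) ≠ 0 := by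
  rw [Ne, CharP.cast_eq_zero_iff L q, Nat.prime_dvd_prime_iff_eq Fact.out Fact.out]
  exact hpq.symm

theorem exists_isPrimitive [IsAlgClosed L] [CharP L q] (hpq : p ≠ q) :
    ∃ ψ : AddChar (ZMod p) L, ψ.IsPrimitive := by
  have : NeZero (p : L) := ⟨natCast_ne_zero_of_ne hpq⟩
  obtain ⟨ζ, hζ⟩ := HasEnoughRootsOfUnity.exists_primitiveRoot L p
  exact ⟨_, AddChar.zmodChar_primitive_of_primitive_root p hζ⟩

theorem apply_mul_gaussSum_pow [CharP L q] (hpq : p ≠ q) (χ : MulChar (ZMod p) L)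
    (ψ : AddChar (ZMod p) L) : (χ ^ q) q * gaussSum χ ψ ^ q = gaussSum (χ ^ q) ψ := by
  have hu : IsUnit (q : ZMod p) := (natCast_ne_zero_of_ne (L := ZMod p) hpq.symm).isUnit
  rw [gaussSum_frob q χ ψ, AddChar.pow_mulShift]
  simpa only [hu.unit_spec] using gaussSum_mulShift (χ ^ q) ψ hu.unit

theorem jacobiSum_pow_of_mod_four_eq_one [IsAlgClosed L] [CharP L q] (hpq : p ≠ q)
    {χ : MulChar (ZMod p) L} (h4 : χ ^ 4 = 1) (h2 : χ ^ 2 ≠ 1) (hq : q % 4 = 1) :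
    χ q * (jacobiSum χ χ ^ 2 * p) ^ (q / 4) = 1 := by
  obtain ⟨ψ, hψ⟩ := exists_isPrimitive (p := p) (q := q) (L := L) hpq
  have h1 : χ ≠ 1 := by rintro rfl; simp at h2
  have hpL := natCast_ne_zero_of_ne (L := L) hpq
  have hg := gaussSum_ne_zero_of_nontrivial (by rwa [ZMod.card]) h1 hψ
  have hχ : χ ^ q = χ := by
    rw [← Nat.div_add_mod q 4, hq, pow_add, pow_mul, h4, one_pow, one_mul, pow_one]
  have hfrob := apply_mul_gaussSum_pow hpq χ ψ
  apply mul_right_cancel₀ hg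
  rw [← gaussSum_pow_four h4 h2 hψ, ← pow_mul, mul_assoc, ← pow_succ,
    show 4 * (q / 4) + 1 = q by omega, one_mul]
  rwa [hχ] at hfrob

theorem jacobiSum_pow_of_mod_four_eq_three [IsAlgClosed L] [CharP L q] (hpq : p ≠ q)
    {χ : MulChar (ZMod p) L} (h4 : χ ^ 4 = 1) (h2 : χ ^ 2 ≠ 1) (hq : q % 4 = 3) :
    (jacobiSum χ χ ^ 2 * p) ^ ((q + 1) / 4) = χ (-q) * p := by
  obtain ⟨ψ, hψ⟩ := exists_isPrimitive (p := p) (q := q) (L := L) hpq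
  have h1 : χ ≠ 1 := by rintro rfl; simp at h2
  have hχ : χ ^ q = χ⁻¹ := by
    rw [← Nat.div_add_mod q 4, hq, pow_add, pow_mul, h4, one_pow, one_mul,
      eq_inv_iff_mul_eq_one, ← pow_succ, h4]
  have hfrob := apply_mul_gaussSum_pow hpq χ ψ
  rw [hχ] at hfrob
  have hneg : χ (-1) * gaussSum χ⁻¹ ψ⁻¹ = gaussSum χ⁻¹ ψ := by
    rw [← inv_apply_neg_one, mul_gaussSum_inv_eq_gaussSum]
  have hcard : gaussSum χ ψ * gaussSum χ⁻¹ ψ⁻¹ = p := by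
    rw [gaussSum_mul_gaussSum_eq_card h1 hψ, ZMod.card]
  have hinv : χ q * χ⁻¹ q = 1 := by
    have hu : IsUnit (q : ZMod p) := (natCast_ne_zero_of_ne (L := ZMod p) hpq.symm).isUnit
    rw [← MulChar.mul_apply, mul_inv_cancel, MulChar.one_apply hu]
  rw [← gaussSum_pow_four h4 h2 hψ, ← pow_mul, show 4 * ((q + 1) / 4) = q + 1 by omega]
  calc gaussSum χ ψ ^ (q + 1) = χ q * (χ⁻¹ q * gaussSum χ ψ ^ q) * gaussSum χ ψ := by
        rw [← mul_assoc, hinv, one_mul, pow_succ]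
    _ = χ (-1) * χ q * (gaussSum χ ψ * gaussSum χ⁻¹ ψ⁻¹) := by rw [hfrob, ← hneg]; ring
    _ = χ (-q) * p := by rw [hcard, ← map_mul, neg_one_mul]

end GaussSum

theorem sum_pow_mul_one_sub_pow_eq_zero {p k : ℕ} [Fact p.Prime] (hk : 2 * k < p - 1) :
    ∑ x : ZMod p, x ^ k * (1 - x) ^ k = 0 := by
  have expand (x : ZMod p) : x ^ k * (1 - x) ^ k =
      ∑ m ∈ Finset.range (k + 1), x ^ (k + (k - m)) * ((-1) ^ (k - m) * (k.choose m : ZMod p)) := by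
    rw [sub_eq_add_neg, add_pow, Finset.mul_sum]
    refine Finset.sum_congr rfl fun m _ => ?_
    rw [one_pow, neg_pow x, pow_add]
    ring
  simp only [expand]
  rw [Finset.sum_comm]
  refine Finset.sum_eq_zero fun m _ => ?_
  rw [← Finset.sum_mul,
    FiniteField.sum_pow_lt_card_sub_one (ZMod p) _ (by rw [ZMod.card]; omega), zero_mul]

theorem odd_re_of_even_im (ho : Odd β.norm) (him : Even β.im) : Odd β.re := by
  rw [norm_eq_sq_add_sq, Int.odd_add] at ho
  exact Int.Odd.of_mul_left (by simpa only [sq] using ho.2 (him.pow_of_ne_zero two_ne_zero))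

theorem even_im_of_mul (ho : Odd α.norm) (h : Even α.im) (hm : Even (α * β).im) : Even β.im := by
  rw [Zsqrtd.im_mul, Int.even_add] at hm
  have hprod : Even (α.re * β.im) := hm.2 (h.mul_right _)
  exact (Int.even_mul.1 hprod).resolve_left (Int.not_even_iff_odd.2 (odd_re_of_even_im ho h))

theorem eq_one_or_eq_neg_one_of_isUnit {u : GaussianInt} (hu : IsUnit u) (him : Even u.im) :
    u = 1 ∨ u = -1 := by
  have hun := (Zsqrtd.norm_eq_one_iff' (by norm_num) u).2 hu
  rw [norm_eq_sq_add_sq] at hun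
  have him0 : u.im = 0 := by
    obtain ⟨m, hm⟩ := him
    have : u.im ≤ 1 := by nlinarith [sq_nonneg u.re]
    have : -1 ≤ u.im := by nlinarith [sq_nonneg u.re]
    omega
  have hre : u.re = 1 ∨ u.re = -1 := by
    rw [him0] at hun
    exact sq_eq_sq_iff_eq_or_eq_neg.1 (by linarith)
  exact hre.imp (fun h => Zsqrtd.ext h him0) fun h => Zsqrtd.ext h (by simpa using him0)

theorem eq_or_eq_neg_of_associated (ho : Odd α.norm) (h : Associated α β) (hα : Even α.im)
    (hβ : Even β.im) : β = α ∨ β = -α := by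
  obtain ⟨u, rfl⟩ := h
  exact (eq_one_or_eq_neg_one_of_isUnit u.isUnit (even_im_of_mul ho hα hβ)).imp
    (fun hu => by rw [hu, mul_one]) fun hu => by rw [hu, mul_neg_one]

theorem associated_of_dvd_of_norm_eq (h0 : α ≠ 0) (h : α ∣ β) (hN : α.norm = β.norm) :
    Associated α β := by
  obtain ⟨w, rfl⟩ := h
  have hα : α.norm ≠ 0 := fun h => h0 ((Zsqrtd.norm_eq_zero_iff (by norm_num) α).1 h)
  rw [Zsqrtd.norm_mul, left_eq_mul₀ hα, Zsqrtd.norm_eq_one_iff' (by norm_num)] at hN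
  exact (associated_mul_unit_right α w hN)

/-- The multiplicative character `χ` is the quartic residue character of `ZMod p`: it takes
values in the powers of `𝒊` and lifts `t ↦ t ^ ((p - 1) / 4)` along the reduction `f`. -/
structure IsQuarticChar {p : ℕ} (f : GaussianInt →+* ZMod p)
    (χ : MulChar (ZMod p) GaussianInt) : Prop where
  map_apply : ∀ t, f (χ t) = t ^ ((p - 1) / 4)
  exists_eq_pow : ∀ t, t ≠ 0 → ∃ k : ℕ, χ t = 𝒊 ^ k

theorem injOn_zero_or_sqrtd_pow {R : Type*} [CommRing R] [Nontrivial R] (f : GaussianInt →+* R)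
    (hπ : Prime π) (ho : Odd π.norm) (hf : f π = 0) :
    Set.InjOn f {w | w = 0 ∨ ∃ k : ℕ, w = 𝒊 ^ k} := by
  have pow_ne_zero (k : ℕ) : f (𝒊 ^ k) ≠ 0 := ((isUnit_sqrtd.pow k).map f).ne_zero
  rintro _ (rfl | ⟨k, rfl⟩) _ (rfl | ⟨l, rfl⟩) h
  · rfl
  · exact absurd (h.symm.trans (map_zero f)) (pow_ne_zero l)
  · exact absurd (h.trans (map_zero f)) (pow_ne_zero k)
  · refine I_pow_eq_iff.1 (I_pow_eq_of_dvd_sqrtd_pow_sub hπ ho ?_)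
    rw [← map_eq_zero_iff_dvd f hπ hf, map_sub, h, sub_self]

theorem exists_map_eq_pow {p : ℕ} [Fact p.Prime] (hp : p % 4 = 1) (hN : π.norm = p)
    {f : GaussianInt →+* ZMod p} (hf : f π = 0) (t : ZMod p) :
    ∃ w : GaussianInt, (w = 0 ∨ ∃ k : ℕ, w = 𝒊 ^ k) ∧ f w = t ^ ((p - 1) / 4) := by
  have hπ := prime_of_norm_eq_prime Fact.out hN
  by_cases ht : t = 0
  · have : (p - 1) / 4 ≠ 0 := by have := (Fact.out : p.Prime).two_le; omega
    exact ⟨0, .inl rfl, by rw [ht, map_zero, zero_pow this]⟩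
  have hft : f (t.val : GaussianInt) = t := by rw [map_natCast, ZMod.natCast_zmod_val]
  have hnd : ¬ π ∣ (t.val : GaussianInt) := by rwa [← map_eq_zero_iff_dvd f hπ hf, hft]
  obtain ⟨k, hk⟩ := exists_dvd_pow_sub_sqrtd_pow hπ (by rw [hN, Int.odd_iff]; omega) hnd
  rw [← map_eq_zero_iff_dvd f hπ hf, map_sub, map_pow, hft, hN, Int.natAbs_natCast,
    sub_eq_zero] at hk
  exact ⟨𝒊 ^ k, .inr ⟨k, rfl⟩, hk.symm⟩

theorem exists_isQuarticChar {p : ℕ} [Fact p.Prime] (hp : p % 4 = 1) (hN : π.norm = p)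
    {f : GaussianInt →+* ZMod p} (hf : f π = 0) : ∃ χ, IsQuarticChar f χ := by
  have hk0 : (p - 1) / 4 ≠ 0 := by have := (Fact.out : p.Prime).two_le; omega
  have inj := injOn_zero_or_sqrtd_pow f (prime_of_norm_eq_prime Fact.out hN)
    (by rw [hN, Int.odd_iff]; omega) hf
  choose w hw hfw using exists_map_eq_pow hp hN hf
  have map_zero' : w 0 = 0 := inj (hw 0) (.inl rfl) (by rw [hfw, zero_pow hk0, map_zero])
  have map_one' : w 1 = 1 :=
    inj (hw 1) (.inr ⟨0, (pow_zero _).symm⟩) (by rw [hfw, one_pow, map_one])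
  have map_mul' (s t : ZMod p) : w (s * t) = w s * w t := by
    refine inj (hw _) ?_ (by rw [map_mul, hfw, hfw, hfw, mul_pow])
    rcases hw s, hw t with ⟨hs | ⟨k, hk⟩, ht | ⟨l, hl⟩⟩
    · exact .inl (by rw [hs, zero_mul])
    · exact .inl (by rw [hs, zero_mul])
    · exact .inl (by rw [ht, mul_zero])
    · exact .inr ⟨k + l, by rw [hk, hl, pow_add]⟩
  refine ⟨⟨⟨⟨w, map_one'⟩, map_mul'⟩, fun t ht => ?_⟩, hfw, fun t ht => ?_⟩
  · rw [isUnit_iff_ne_zero, not_not] at ht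
    exact ht ▸ map_zero'
  · refine (hw t).resolve_left fun h0 => pow_ne_zero ((p - 1) / 4) ht ?_
    rw [← hfw, h0, map_zero]

namespace IsQuarticChar

variable {p : ℕ} [Fact p.Prime] {f : GaussianInt →+* ZMod p} {χ : MulChar (ZMod p) GaussianInt}

theorem pow_four (hχ : IsQuarticChar f χ) : χ ^ 4 = 1 := by
  refine MulChar.ext fun a => ?_
  obtain ⟨k, hk⟩ := hχ.exists_eq_pow a a.ne_zero
  rw [MulChar.pow_apply_coe, hk, pow_right_comm, sqrtd_pow_four, one_pow, MulChar.one_apply_coe]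

theorem residueSymbol_eq (hχ : IsQuarticChar f χ) (hp : p % 4 = 1) (hN : π.norm = p)
    (hf : f π = 0) {k : ℕ} (hk : χ (f α) = 𝒊 ^ k) : quarticResidueSymbol α π = I ^ k := by
  have hπ := prime_of_norm_eq_prime Fact.out hN
  refine residueSymbol_eq_I_pow hπ (by rw [hN, Int.odd_iff]; omega) ?_ ?_
  · rw [← map_eq_zero_iff_dvd f hπ hf]
    intro h
    rw [h, MulChar.map_zero] at hk
    exact (isUnit_sqrtd.pow k).ne_zero hk.symm
  · rw [← map_eq_zero_iff_dvd f hπ hf, map_sub, ← hk, hχ.map_apply, map_pow, hN,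
      Int.natAbs_natCast, sub_self]

theorem exists_sq_eq_neg_one (hχ : IsQuarticChar f χ) (hp : p % 4 = 1) :
    ∃ t : ZMod p, t ≠ 0 ∧ χ t ^ 2 = -1 := by
  have hp2 : ringChar (ZMod p) ≠ 2 := by rw [ZMod.ringChar_zmod_n]; omega
  obtain ⟨t, ht⟩ := FiniteField.exists_nonsquare hp2
  have h0 : t ≠ 0 := by rintro rfl; exact ht .zero
  obtain ⟨k, hk⟩ := hχ.exists_eq_pow t h0
  have hsq : χ t ^ 2 = (-1) ^ k := by rw [hk, pow_right_comm, sqrtd_sq]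
  refine ⟨t, h0, hsq.trans ((neg_one_pow_eq_or _ k).resolve_left fun hone => ht ?_)⟩
  have hft := congrArg f (hsq.trans hone)
  rw [map_pow, hχ.map_apply, map_one, ← pow_mul] at hft
  rwa [ZMod.euler_criterion p h0, show p / 2 = (p - 1) / 4 * 2 by omega]

theorem ringHomComp_sq_ne_one (hχ : IsQuarticChar f χ) (hp : p % 4 = 1) {R : Type*} [CommRing R]
    (hR : (-1 : R) ≠ 1) (φ : GaussianInt →+* R) : χ.ringHomComp φ ^ 2 ≠ 1 := by
  obtain ⟨t, h0, ht⟩ := hχ.exists_sq_eq_neg_one hp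
  intro h
  have happ := DFunLike.congr_fun h t
  rw [MulChar.pow_apply' _ two_ne_zero, MulChar.ringHomComp_apply, MulChar.one_apply h0.isUnit,
    ← map_pow, ht, map_neg, map_one] at happ
  exact hR happ

theorem ringHomComp_pow_four (hχ : IsQuarticChar f χ) {R : Type*} [CommRing R]
    (φ : GaussianInt →+* R) : χ.ringHomComp φ ^ 4 = 1 := by
  rw [MulChar.ringHomComp_pow, hχ.pow_four, MulChar.ringHomComp_one]

theorem ringHomComp_star (hχ : IsQuarticChar f χ) :
    χ.ringHomComp (starRingEnd GaussianInt) = χ⁻¹ := by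
  rw [eq_inv_iff_mul_eq_one]
  refine MulChar.ext fun a => ?_
  obtain ⟨k, hk⟩ := hχ.exists_eq_pow a a.ne_zero
  rw [MulChar.mul_apply, MulChar.one_apply_coe, MulChar.ringHomComp_apply, hk, map_pow, ← mul_pow,
    show starRingEnd GaussianInt 𝒊 * 𝒊 = 1 by decide, one_pow]

theorem jacobiSum_mul_star (hχ : IsQuarticChar f χ) (hp : p % 4 = 1) :
    jacobiSum χ χ * star (jacobiSum χ χ) = p := by
  have hchar : ringChar ℂ ≠ ringChar (ZMod p) := by
    rw [ZMod.ringChar_zmod_n, ringChar.eq ℂ 0]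
    exact (Fact.out : p.Prime).ne_zero.symm
  have h2 := hχ.ringHomComp_sq_ne_one hp (by norm_num) GaussianInt.toComplex
  have h1 : χ.ringHomComp GaussianInt.toComplex ≠ 1 := fun h => h2 (by rw [h, one_pow])
  have h := jacobiSum_mul_jacobiSum_inv hchar h1 h1 (by rwa [← sq])
  rw [MulChar.ringHomComp_inv, jacobiSum_ringHomComp, jacobiSum_ringHomComp,
    ← hχ.ringHomComp_star, jacobiSum_ringHomComp, ← map_mul, ZMod.card] at h
  apply GaussianInt.toComplex_injective
  rw [map_natCast, ← h]
  rfl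

theorem dvd_jacobiSum (hχ : IsQuarticChar f χ) (hN : π.norm = p) (hf : f π = 0) :
    π ∣ jacobiSum χ χ := by
  rw [← map_eq_zero_iff_dvd f (prime_of_norm_eq_prime Fact.out hN) hf, jacobiSum, map_sum]
  simp only [map_mul, hχ.map_apply]
  have := (Fact.out : p.Prime).two_le
  exact sum_pow_mul_one_sub_pow_eq_zero (by omega)

theorem even_im_jacobiSum (hχ : IsQuarticChar f χ) (hp : p % 4 = 1) :
    Even (jacobiSum χ χ).im := by
  have hprim : IsPrimitiveRoot 𝒊 4 :=
    .mk_of_lt _ (by norm_num) sqrtd_pow_four fun l _ _ => by interval_cases l <;> decide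
  obtain ⟨z, -, hz⟩ := exists_jacobiSum_eq_neg_one_add (by norm_num) hχ.pow_four hχ.pow_four
    (by rw [ZMod.card]; omega) hprim
  refine ⟨-z.re, ?_⟩
  rw [hz, show (𝒊 - 1) ^ 2 = ((-2 : ℤ) : GaussianInt) * 𝒊 by push_cast; linear_combination sqrtd_sq]
  simp
  ring

theorem jacobiSum_eq_or_eq_neg (hχ : IsQuarticChar f χ) (hp : p % 4 = 1) (hN : π.norm = p)
    (hf : f π = 0) (him : Even π.im) : jacobiSum χ χ = π ∨ jacobiSum χ χ = -π := by
  have ho : Odd π.norm := by rw [hN, Int.odd_iff]; omega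
  have hJN : π.norm = (jacobiSum χ χ).norm := by
    have := Zsqrtd.norm_eq_mul_conj (jacobiSum χ χ)
    rw [hχ.jacobiSum_mul_star hp] at this
    rw [hN]
    exact_mod_cast this.symm
  exact eq_or_eq_neg_of_associated ho
    (associated_of_dvd_of_norm_eq (ne_zero_of_odd_norm ho) (hχ.dvd_jacobiSum hN hf) hJN) him
    (hχ.even_im_jacobiSum hp)

end IsQuarticChar

end JacobiSum

/-! ### Quartic reciprocity with a rational argument -/

section Reciprocity

variable {α β γ π : GaussianInt}

theorem jacobi_neg_intCast {n : ℤ} (hn : Odd n) (α : GaussianInt) : Jac (-α) n = Jac α n := by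
  have hneg : Jac (-1) n = 1 := by
    simpa using jacobi_intCast_intCast (r := -1) hn (by simpa using isCoprime_one_left.neg_left)
  rw [← neg_one_mul, jacobi_mul_left (odd_norm_intCast hn), hneg, one_mul]

theorem exists_hom_of_dvd_natCast {κ : GaussianInt} (hκ : Prime κ) {q : ℕ} (hq : q.Prime)
    (h : κ ∣ q) : ∃ (L : Type) (_ : Field L) (_ : IsAlgClosed L) (_ : CharP L q)
      (φ : GaussianInt →+* L), φ κ = 0 := by
  have : (Ideal.span {κ}).IsMaximal := PrincipalIdealRing.isMaximal_of_irreducible hκ.irreducible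
  let := Ideal.Quotient.field (Ideal.span {κ})
  have hq0 : (q : GaussianInt ⧸ Ideal.span {κ}) = 0 := by
    rwa [← map_natCast (Ideal.Quotient.mk _), Ideal.Quotient.eq_zero_iff_mem,
      Ideal.mem_span_singleton]
  have : CharP (GaussianInt ⧸ Ideal.span {κ}) q :=
    ringChar.of_eq (CharP.ringChar_of_prime_eq_zero hq hq0)
  refine ⟨AlgebraicClosure (GaussianInt ⧸ Ideal.span {κ}), inferInstance, inferInstance,
    charP_of_injective_algebraMap' (GaussianInt ⧸ Ideal.span {κ}) q,
    (algebraMap _ _).comp (Ideal.Quotient.mk (Ideal.span {κ})), ?_⟩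
  rw [RingHom.comp_apply, Ideal.Quotient.eq_zero_iff_mem.2 (Ideal.mem_span_singleton_self κ),
    map_zero]

namespace IsQuarticChar

variable {p q : ℕ} [Fact p.Prime] [Fact q.Prime] {f : GaussianInt →+* ZMod p}
  {χ : MulChar (ZMod p) GaussianInt} {κ : GaussianInt}

theorem dvd_mul_jacobiSum_pow_sub_one (hχ : IsQuarticChar f χ) (hp : p % 4 = 1) (hpq : p ≠ q)
    (hq : q % 4 = 1) (hκ : Prime κ) (h : κ ∣ q) :
    κ ∣ χ q * (jacobiSum χ χ ^ 2 * p) ^ (q / 4) - 1 := by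
  obtain ⟨L, _, _, _, φ, hφ⟩ := exists_hom_of_dvd_natCast hκ Fact.out h
  have hL : (-1 : L) ≠ 1 := Ring.neg_one_ne_one_of_char_ne_two (by rw [ringChar.eq L q]; omega)
  have key := jacobiSum_pow_of_mod_four_eq_one hpq (hχ.ringHomComp_pow_four φ)
    (hχ.ringHomComp_sq_ne_one hp hL φ) hq
  rw [jacobiSum_ringHomComp, MulChar.ringHomComp_apply] at key
  rw [← map_eq_zero_iff_dvd φ hκ hφ, map_sub, map_mul, map_pow, map_mul, map_pow, map_natCast φ,
    key, map_one, sub_self]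

theorem dvd_jacobiSum_pow_sub_mul (hχ : IsQuarticChar f χ) (hp : p % 4 = 1) (hpq : p ≠ q)
    (hq : q % 4 = 3) :
    (q : GaussianInt) ∣ (jacobiSum χ χ ^ 2 * p) ^ ((q + 1) / 4) - χ (-q) * p := by
  have hκ := GaussianInt.prime_of_nat_prime_of_mod_four_eq_three q hq
  obtain ⟨L, _, _, _, φ, hφ⟩ := exists_hom_of_dvd_natCast hκ Fact.out dvd_rfl
  have hL : (-1 : L) ≠ 1 := Ring.neg_one_ne_one_of_char_ne_two (by rw [ringChar.eq L q]; omega)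
  have key := jacobiSum_pow_of_mod_four_eq_three hpq (hχ.ringHomComp_pow_four φ)
    (hχ.ringHomComp_sq_ne_one hp hL φ) hq
  rw [jacobiSum_ringHomComp, MulChar.ringHomComp_apply] at key
  rw [← map_eq_zero_iff_dvd φ hκ hφ, map_sub, map_pow, map_mul, map_pow, map_mul, map_natCast, key,
    sub_self]

theorem not_dvd_jacobiSum (hχ : IsQuarticChar f χ) (hp : p % 4 = 1) (hpq : p ≠ q) (hκ : Prime κ)
    (h : κ ∣ q) : ¬ κ ∣ jacobiSum χ χ ∧ ¬ κ ∣ star (jacobiSum χ χ) := by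
  obtain ⟨L, _, _, _, φ, hφ⟩ := exists_hom_of_dvd_natCast hκ Fact.out h
  have hprod : φ (jacobiSum χ χ) * φ (star (jacobiSum χ χ)) ≠ 0 := by
    rw [← map_mul, hχ.jacobiSum_mul_star hp, map_natCast]
    exact natCast_ne_zero_of_ne hpq
  simpa only [ne_eq, mul_eq_zero, not_or, map_eq_zero_iff_dvd φ hκ hφ] using hprod

theorem jacobiSymbol_natCast_of_mod_four_eq_one (hχ : IsQuarticChar f χ) (hp : p % 4 = 1)
    (hpq : p ≠ q) (hq : q % 4 = 1) {c : ℕ} (hc : χ q = 𝒊 ^ c) :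
    Jac (jacobiSum χ χ) q = I ^ c := by
  obtain ⟨κ, hκ, hκN⟩ := exists_prime_norm_eq (q := q) Fact.out hq
  have hκo : Odd κ.norm := by rw [hκN, Int.odd_iff]; omega
  have hκq : κ ∣ q := by simpa [hκN] using dvd_norm κ
  set J := jacobiSum χ χ
  obtain ⟨hJ, hJ'⟩ := hχ.not_dvd_jacobiSum hp hpq hκ hκq
  have hcop {w : GaussianInt} (hw : ¬ κ ∣ w) : IsCoprime w κ :=
    ((irreducible_iff_prime.2 hκ).coprime_iff_not_dvd.2 hw).symm
  obtain ⟨k, hk, hdvd⟩ := exists_residueSymbol_eq_I_pow (α := J ^ 2 * p) hκ hκo (by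
    rw [← hχ.jacobiSum_mul_star hp]
    exact hκ.not_dvd_mul (mt hκ.dvd_of_dvd_pow hJ) (hκ.not_dvd_mul hJ hJ'))
  have hck : I ^ c * I ^ k = 1 := by
    rw [← pow_add, ← pow_zero I]
    refine I_pow_eq_of_dvd_sqrtd_pow_sub hκ hκo ?_
    have hpow := hχ.dvd_mul_jacobiSum_pow_sub_one hp hpq hq hκ hκq
    rw [hκN, Int.natAbs_natCast, show (q - 1) / 4 = q / 4 by omega] at hdvd
    rw [hc] at hpow
    convert hpow.sub (hdvd.mul_left (𝒊 ^ c)) using 1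
    ring
  have hJstar : Jac J (star κ) * Jac (star J) κ = 1 := by
    rw [← star_star J, jacobi_star hκo, star_star, mul_comm]
    exact jacobi_mul_star_self hκo (hcop hJ')
  have hsymbol : I ^ k = Jac J κ ^ 3 * Jac (star J) κ := by
    rw [← hk, ← jacobi_prime hκ, ← hχ.jacobiSum_mul_star hp, jacobi_mul_left hκo,
      jacobi_pow_left hκo, jacobi_mul_left hκo]
    ring
  have hJq : Jac J q = Jac J κ * Jac J (star κ) := by
    rw [← jacobi_norm_right hκ.ne_zero, hκN, Int.cast_natCast]
  rw [hsymbol] at hck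
  rw [hJq]
  linear_combination (-Jac J κ * Jac J (star κ)) * hck + I ^ c * Jac J κ ^ 4 * hJstar +
    I ^ c * jacobi_pow_four hκo (hcop hJ)

theorem jacobiSymbol_natCast_of_mod_four_eq_three (hχ : IsQuarticChar f χ) (hp : p % 4 = 1)
    (hpq : p ≠ q) (hq : q % 4 = 3) {c : ℕ} (hc : χ (-q) = 𝒊 ^ c) :
    Jac (jacobiSum χ χ) q = I ^ c := by
  have hκ := GaussianInt.prime_of_nat_prime_of_mod_four_eq_three q hq
  have hqo := odd_norm_natCast (n := q) (Int.odd_iff.2 (by omega))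
  have hJ := (hχ.not_dvd_jacobiSum hp hpq hκ dvd_rfl).1
  set J := jacobiSum χ χ
  rw [jacobi_prime hκ]
  refine residueSymbol_eq_I_pow hκ hqo hJ ?_
  rw [natAbs_norm_natCast_sub_one_div_four hq]
  have hp_sub : (q : GaussianInt) ∣ p - J ^ (q + 1) := by
    rw [← hχ.jacobiSum_mul_star hp, pow_succ', ← mul_sub]
    exact (dvd_sub_comm.1 (natCast_dvd_pow_sub_star Fact.out hq J)).mul_left J
  have hpow_sub := (hp_sub.mul_left (J ^ 2)).trans
    ((dvd_of_eq (mul_sub _ _ _)).trans (sub_dvd_pow_sub_pow _ _ ((q + 1) / 4)))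
  have key := hχ.dvd_jacobiSum_pow_sub_mul hp hpq hq
  rw [hc] at key
  refine (hκ.dvd_or_dvd (b := J ^ (q + 1)) ?_).resolve_right (mt hκ.dvd_of_dvd_pow hJ)
  have hexp : J ^ ((q - 1) * ((q + 1) / 4)) * J ^ (q + 1) =
      (J ^ 2 * J ^ (q + 1)) ^ ((q + 1) / 4) := by
    rw [← pow_add, ← pow_add, ← pow_mul]
    congr 1
    obtain ⟨e, rfl⟩ : ∃ e, q = 4 * e + 3 := ⟨q / 4, by omega⟩
    rw [show (4 * e + 3 + 1) / 4 = e + 1 by omega, show 4 * e + 3 - 1 = 4 * e + 2 by omega]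
    ring
  rw [sub_mul, hexp]
  convert (key.sub hpow_sub).add (hp_sub.mul_left (𝒊 ^ c)) using 1
  ring

end IsQuarticChar

theorem reciprocity_of_norm_eq_prime {p q : ℕ} (hp : p.Prime) (hN : π.norm = p) (ho : Odd π.norm)
    (him : Even π.im) (hq : q.Prime) (hqo : Odd (q : ℤ)) (hpq : p ≠ q) :
    Jac ((ZMod.χ₄ q * q : ℤ) : GaussianInt) π = Jac π q := by
  have := Fact.mk hp
  have := Fact.mk hq
  have hp4 : p % 4 = 1 := by have := norm_emod_four ho; omega
  have hπ := prime_of_norm_eq_prime hp hN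
  obtain ⟨f, hf⟩ := exists_hom_zmod hN
  obtain ⟨χ, hχ⟩ := exists_isQuarticChar hp4 hN hf
  have hJ : Jac (jacobiSum χ χ) q = Jac π q := by
    rcases hχ.jacobiSum_eq_or_eq_neg hp4 hN hf him with h | h <;> rw [h]
    simpa using jacobi_neg_intCast hqo π
  have hq0 : (q : ZMod p) ≠ 0 := natCast_ne_zero_of_ne hpq.symm
  obtain hq4 | hq4 : q % 4 = 1 ∨ q % 4 = 3 := by rw [Int.odd_iff] at hqo; omega
  · obtain ⟨c, hc⟩ := hχ.exists_eq_pow q hq0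
    rw [ZMod.χ₄_nat_one_mod_four hq4, one_mul, jacobi_prime hπ,
      hχ.residueSymbol_eq hp4 hN hf (k := c) (by rwa [Int.cast_natCast, map_natCast f]), ← hJ,
      hχ.jacobiSymbol_natCast_of_mod_four_eq_one hp4 hpq hq4 hc]
  · obtain ⟨c, hc⟩ := hχ.exists_eq_pow (-q) (neg_ne_zero.2 hq0)
    rw [ZMod.χ₄_nat_three_mod_four hq4, neg_one_mul, jacobi_prime hπ,
      hχ.residueSymbol_eq hp4 hN hf (k := c)
        (by rwa [Int.cast_neg, Int.cast_natCast, map_neg, map_natCast f]), ← hJ,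
      hχ.jacobiSymbol_natCast_of_mod_four_eq_three hp4 hpq hq4 hc]

theorem isUnit_χ₄ {n : ℤ} (hn : Odd n) : IsUnit (ZMod.χ₄ n) := by
  rw [Int.isUnit_iff, ZMod.χ₄_int_eq_if_mod_four]
  rw [Int.odd_iff] at hn
  split_ifs <;> simp_all

theorem exists_intCast_of_associated_natCast {l : ℕ} (hl : Odd (l : ℤ)) (h : Associated π l)
    (him : Even π.im) : ∃ r : ℤ, Odd r ∧ π = r := by
  rcases eq_or_eq_neg_of_associated (odd_norm_natCast hl) h.symm (by simp) him with h | h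
  · exact ⟨l, hl, by simpa using h⟩
  · exact ⟨-l, hl.neg, by simpa using h⟩

theorem reciprocity_prime (hπ : Prime π) (ho : Odd π.norm) (him : Even π.im) {q : ℕ}
    (hq : q.Prime) (hqo : Odd (q : ℤ)) (hc : IsCoprime π q) :
    Jac ((ZMod.χ₄ q * q : ℤ) : GaussianInt) π = Jac π q := by
  rcases split_or_inert hπ with ⟨p, hp, hN⟩ | ⟨l, -, hl3, ha⟩
  · refine reciprocity_of_norm_eq_prime hp hN ho him hq hqo ?_
    rintro rfl
    exact hπ.not_isUnit (hc.isUnit_of_dvd' dvd_rfl (by simpa [hN] using dvd_norm π))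
  · obtain ⟨r, hr, rfl⟩ :=
      exists_intCast_of_associated_natCast (Int.odd_iff.2 (by omega)) ha him
    have hcop : IsCoprime ((ZMod.χ₄ q * q : ℤ) : GaussianInt) r := by
      push_cast
      exact (isCoprime_mul_unit_left_left ((isUnit_χ₄ hqo).map (Int.castRingHom GaussianInt))
        _ _).2 hc.symm
    rw [jacobi_intCast_intCast hr hcop]
    simpa using (jacobi_intCast_intCast hqo (by simpa using hc)).symm

theorem exists_associated_even_im (ho : Odd π.norm) : ∃ π', Associated π' π ∧ Even π'.im := by
  by_cases h : Even π.im
  · exact ⟨π, .refl _, h⟩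
  · refine ⟨𝒊 * π, associated_unit_mul_left _ _ isUnit_sqrtd, ?_⟩
    rw [norm_eq_sq_add_sq, ← Int.not_even_iff_odd, Int.even_add] at ho
    simp only [Int.even_pow' two_ne_zero] at ho
    have hre : Even π.re := by tauto
    simpa using hre

theorem even_im_induction {P : GaussianInt → Prop} (one : P 1) (neg_one : P (-1))
    (mul : ∀ π β, Prime π → Odd π.norm → Even π.im → Odd β.norm → P β → P (π * β))
    (ho : Odd γ.norm) (him : Even γ.im) : P γ := by
  suffices h : ∀ γ', Associated γ' γ → Even γ'.im → P γ' from h γ (.refl _) him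
  clear him
  induction γ, ho using odd_norm_induction with
  | unit u _ hu =>
    intro γ ha him
    rcases eq_one_or_eq_neg_one_of_isUnit (ha.symm.isUnit hu) him with rfl | rfl
    exacts [one, neg_one]
  | mul π β hπ hπo ho _ ih =>
    intro γ ha him
    obtain ⟨π', hπ', hπim⟩ := exists_associated_even_im hπo
    have hπo' : Odd π'.norm := by rwa [Zsqrtd.norm_eq_of_associated (by norm_num) hπ']
    obtain ⟨β', rfl⟩ := hπ'.dvd.trans ((dvd_mul_right π β).trans ha.symm.dvd)
    have hβ : Associated β' β := ha.of_mul_left hπ' (ne_zero_of_odd_norm hπo')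
    exact mul _ _ (hπ'.symm.prime hπ) hπo' hπim
      (by rwa [Zsqrtd.norm_eq_of_associated (by norm_num) hβ])
      (ih _ hβ (even_im_of_mul hπo' hπim him))

theorem reciprocity_natCast_prime (ho : Odd γ.norm) (him : Even γ.im) {q : ℕ} (hq : q.Prime)
    (hqo : Odd (q : ℤ)) (hc : IsCoprime γ q) :
    Jac ((ZMod.χ₄ q * q : ℤ) : GaussianInt) γ = Jac γ q := by
  have hqo' := odd_norm_natCast hqo
  revert hc
  refine even_im_induction (P := fun γ => IsCoprime γ q →
    Jac ((ZMod.χ₄ q * q : ℤ) : GaussianInt) γ = Jac γ q) (fun _ => ?_) (fun _ => ?_)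
    (fun π β hπ hπo hπim ho ih hc => ?_) ho him
  · rw [jacobi_one_right, jacobi_one_left hqo']
  · rw [jacobi_neg_right one_ne_zero, jacobi_one_right]
    simpa [jacobi_one_left hqo'] using (jacobi_neg_intCast hqo 1).symm
  · rw [jacobi_mul_right hπ.ne_zero (ne_zero_of_odd_norm ho), jacobi_mul_left hqo',
      reciprocity_prime hπ hπo hπim hq hqo hc.of_mul_left_left, ih hc.of_mul_left_right]

theorem reciprocity_χ₄ (ho : Odd γ.norm) (him : Even γ.im) {n : ℤ} (hn : Odd n)
    (hc : IsCoprime γ n) : Jac ((ZMod.χ₄ n * n : ℤ) : GaussianInt) γ = Jac γ n := by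
  induction n, hn using int_odd_induction with
  | one => simp [jacobi_one_right, jacobi_one_left ho]
  | neg n hn ih =>
    push_cast at hc
    rw [show ZMod.χ₄ (-n : ℤ) * -n = ZMod.χ₄ n * n by
      rw [Int.cast_neg, ← neg_one_mul (n : ZMod 4), map_mul, show ZMod.χ₄ (-1) = -1 from rfl]; ring,
      ih (IsCoprime.neg_right_iff _ _ |>.1 hc), Int.cast_neg,
      jacobi_neg_right (intCast_ne_zero_of_odd hn)]
  | mul q n hq hqo hn ih =>
    push_cast at hc
    rw [show ZMod.χ₄ (q * n : ℤ) * (q * n) = (ZMod.χ₄ q * q) * (ZMod.χ₄ n * n) by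
      rw [Int.cast_mul, map_mul, Int.cast_natCast]; ring, Int.cast_mul, jacobi_mul_left ho,
      reciprocity_natCast_prime ho him hq hqo hc.of_mul_right_left, ih hc.of_mul_right_right,
      Int.cast_mul, Int.cast_natCast, jacobi_mul_right
        (ne_zero_of_odd_norm (odd_norm_natCast hqo)) (intCast_ne_zero_of_odd hn)]

theorem reciprocity (ho : Odd γ.norm) (him : Even γ.im) {n : ℤ} (hn : n % 4 = 1)
    (hc : IsCoprime γ n) : Jac n γ = Jac γ n := by
  rw [← reciprocity_χ₄ ho him (Int.odd_iff.2 (by omega)) hc, ZMod.χ₄_int_one_mod_four hn, one_mul]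

end Reciprocity

/-! ### Supplementary laws -/

section Supplements

variable {α β : GaussianInt}

theorem odd_of_eq_four_mul_add_one {n k : ℤ} (h : n = 4 * k + 1) : Odd n := ⟨2 * k, by omega⟩

theorem odd_norm_of_re_im {k l : ℤ} (hre : β.re = 2 * k + 1) (him : β.im = 2 * l) :
    Odd β.norm := by
  rw [norm_eq_sq_add_sq, hre, him]; exact ⟨2 * (k ^ 2 + k + l ^ 2), by ring⟩

theorem isCoprime_intCast {m n : ℤ} (h : IsCoprime m n) :
    IsCoprime (m : GaussianInt) (n : GaussianInt) := h.map (Int.castRingHom GaussianInt)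

theorem isCoprime_re (hc : IsCoprime α.re α.im) : IsCoprime α α.re := by
  nth_rw 1 [eq_re_add_im_mul_sqrtd α, add_comm, ← mul_one (α.re : GaussianInt)]
  rw [IsCoprime.add_mul_left_left_iff]
  exact (isCoprime_intCast hc.symm).mul_left ⟨-𝒊, 0, by linear_combination -sqrtd_sq⟩

theorem jacobi_intCast_mul_sqrtd {n k r : ℤ} (hn : n = 4 * k + 1)
    (hc : IsCoprime (r : GaussianInt) n) : Jac (r * 𝒊) n = I ^ (2 * k) := by
  have hno := odd_of_eq_four_mul_add_one hn
  rw [jacobi_mul_left (odd_norm_intCast hno), jacobi_intCast_intCast hno hc, one_mul,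
    jacobi_sqrtd (e := 4 * k ^ 2 + 2 * k) (by rw [Zsqrtd.norm_intCast, hn]; ring)]
  exact I_zpow_eq_of_modEq (Int.modEq_iff_dvd.2 ⟨-k ^ 2, by ring⟩)

theorem jacobi_sqrtd_intCast {n k : ℤ} (hn : n = 4 * k + 1) : Jac 𝒊 n = I ^ (2 * k) := by
  simpa using jacobi_intCast_mul_sqrtd (r := 1) hn (by simpa using isCoprime_one_left)

theorem jacobi_self_re {k : ℤ} (hk : α.re = 4 * k + 1) (hc : IsCoprime α α.re) :
    Jac α α.re = I ^ (2 * k) := by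
  have him : IsCoprime (α.im : GaussianInt) α.re := by
    nth_rw 1 [eq_re_add_im_mul_sqrtd α, add_comm, ← mul_one (α.re : GaussianInt)] at hc
    exact (IsCoprime.add_mul_left_left_iff.1 hc).of_mul_left_left
  rw [← jacobi_intCast_mul_sqrtd hk him]
  refine jacobi_congr (odd_norm_intCast (odd_of_eq_four_mul_add_one hk)) ⟨1, ?_⟩
  linear_combination eq_re_add_im_mul_sqrtd α

theorem neg_one_zpow_eq (n : ℤ) : (-1 : ℂ) ^ n = I ^ (2 * n) := by
  rw [zpow_mul, zpow_ofNat, Complex.I_sq]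

theorem jacobi_im_of_re_eq {k l : ℤ} (hk : β.re = 4 * k + 1) (hl : β.im = 2 * l)
    (hc : IsCoprime β.re β.im) : Jac β.im β = I ^ l ^ 2 := by
  have ho : Odd β.norm := odd_norm_of_re_im (k := 2 * k) (by rw [hk]; ring) hl
  have hN : β.norm = 4 * (4 * k ^ 2 + 2 * k + l ^ 2) + 1 := by
    rw [norm_eq_sq_add_sq, hk, hl]; ring
  calc Jac β.im β = Jac (𝒊 * β.re) β := jacobi_congr ho ⟨-𝒊, by
        linear_combination 𝒊 * eq_re_add_im_mul_sqrtd β + β.im * sqrtd_sq⟩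
    _ = I ^ (4 * k ^ 2 + 2 * k + l ^ 2) * I ^ (2 * k) := by
      rw [jacobi_mul_left ho, jacobi_sqrtd hN,
        reciprocity ho ⟨l, hl.trans (two_mul l)⟩ (by omega) (isCoprime_re hc),
        jacobi_self_re hk (isCoprime_re hc)]
    _ = I ^ l ^ 2 := by
      rw [← zpow_add₀ Complex.I_ne_zero]
      exact I_zpow_eq_of_modEq (Int.modEq_iff_dvd.2 ⟨-k ^ 2 - k, by ring⟩)

theorem jacobi_im {k l : ℤ} (hk : β.re = 2 * k + 1) (hl : β.im = 2 * l)
    (hc : IsCoprime β.re β.im) : Jac β.im β = I ^ (l ^ 2 + 2 * (k * l)) := by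
  have hN : β.norm = 4 * (k ^ 2 + k + l ^ 2) + 1 := by rw [norm_eq_sq_add_sq, hk, hl]; ring
  have ho := odd_norm_of_re_im hk hl
  obtain ⟨j, rfl | rfl⟩ := Int.even_or_odd' k
  · rw [jacobi_im_of_re_eq (k := j) (by rw [hk]; ring) hl hc]
    exact I_zpow_eq_of_modEq (Int.modEq_iff_dvd.2 ⟨j * l, by ring⟩)
  · have hneg : Jac ((-β).im) (-β) = I ^ (-l) ^ 2 :=
      jacobi_im_of_re_eq (k := -j - 1) (by rw [Zsqrtd.re_neg, hk]; ring)
        (by rw [Zsqrtd.im_neg, hl]; ring) (by simpa using hc.neg_neg)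
    rw [jacobi_neg_right (ne_zero_of_odd_norm ho), Zsqrtd.im_neg, Int.cast_neg, neg_sq] at hneg
    obtain ⟨m, hm⟩ := (Int.even_mul_succ_self l).two_dvd
    rw [← neg_neg (β.im : GaussianInt), ← neg_one_mul, jacobi_mul_left ho, hneg, jacobi_neg_one hN,
      neg_one_zpow_eq, ← zpow_add₀ Complex.I_ne_zero]
    exact I_zpow_eq_of_modEq (Int.modEq_iff_dvd.2
      ⟨j * l - 2 * j ^ 2 - 3 * j - 1 + l - m, by linear_combination -2 * hm⟩)

theorem jacobi_neg_one_of_four_dvd_im {k l : ℤ} (hre : β.re = 4 * k + 1) (him : β.im = 4 * l) :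
    Jac (-1) β = 1 := by
  have hN : β.norm = 4 * (4 * k ^ 2 + 2 * k + 4 * l ^ 2) + 1 := by
    rw [norm_eq_sq_add_sq, hre, him]; ring
  rw [jacobi_neg_one hN]
  exact Even.neg_one_zpow ⟨2 * k ^ 2 + k + 2 * l ^ 2, by ring⟩

theorem jacobi_one_add_sqrtd {k l : ℤ} (hre : β.re = 4 * k + 1) (him : β.im = 4 * l)
    (hc : IsCoprime β.re β.im) : Jac (1 + 𝒊) β = I ^ (k - l) := by
  have ho : Odd β.norm :=
    odd_norm_of_re_im (k := 2 * k) (l := 2 * l) (by rw [hre]; ring) (by rw [him]; ring)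
  have hβ := eq_re_add_im_mul_sqrtd β
  obtain ⟨n, hn⟩ : ∃ n, n = β.re - β.im := ⟨_, rfl⟩
  have hn4 : n = 4 * (k - l) + 1 := by rw [hn, hre, him]; ring
  have hno := odd_norm_intCast (odd_of_eq_four_mul_add_one hn4)
  have hβn : β = β.im * (1 + 𝒊) + n * 1 := by rw [hn]; push_cast; linear_combination hβ
  have hcn : IsCoprime (β.im : GaussianInt) n := by
    obtain ⟨r, s, hrs⟩ := hc
    exact isCoprime_intCast ⟨r + s, r, by linear_combination hrs + r * hn⟩
  have him_one : Jac β.im β = 1 := by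
    rw [jacobi_im_of_re_eq hre (l := 2 * l) (by rw [him]; ring) hc, mul_pow]
    exact I_zpow_four_mul _
  have hcop : IsCoprime β n := by
    rw [hβn, IsCoprime.add_mul_left_left_iff]
    exact hcn.mul_left (isCoprime_one_add_sqrtd hno)
  calc Jac (1 + 𝒊) β = Jac (β.im * (1 + 𝒊)) β := by rw [jacobi_mul_left ho, him_one, one_mul]
    _ = Jac (-1 * n) β := jacobi_congr ho ⟨1, by linear_combination -hβn⟩
    _ = Jac β n := by
      rw [jacobi_mul_left ho, jacobi_neg_one_of_four_dvd_im hre him, one_mul,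
        reciprocity ho ⟨2 * l, by rw [him]; ring⟩ (by omega) hcop]
    _ = Jac (β.im * (1 + 𝒊)) n := jacobi_congr hno ⟨1, by linear_combination hβn⟩
    _ = I ^ (k - l) := by
      rw [jacobi_mul_left hno, jacobi_intCast_intCast (odd_of_eq_four_mul_add_one hn4) hcn, one_mul,
        jacobi_one_add_sqrtd_intCast hn4]

theorem two_eq : (2 : GaussianInt) = -1 * 𝒊 * (1 + 𝒊) ^ 2 := by decide

theorem jacobi_two {k l : ℤ} (hre : β.re = 4 * k + 1) (him : β.im = 4 * l)
    (hc : IsCoprime β.re β.im) : Jac 2 β = I ^ (2 * l) := by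
  have hN : β.norm = 4 * (4 * k ^ 2 + 2 * k + 4 * l ^ 2) + 1 := by
    rw [norm_eq_sq_add_sq, hre, him]; ring
  have ho := odd_of_eq_four_mul_add_one hN
  rw [two_eq, jacobi_mul_left ho, jacobi_mul_left ho, jacobi_pow_left ho,
    jacobi_neg_one_of_four_dvd_im hre him, jacobi_sqrtd hN, jacobi_one_add_sqrtd hre him hc,
    one_mul, ← zpow_natCast, ← zpow_mul, ← zpow_add₀ Complex.I_ne_zero]
  exact I_zpow_eq_of_modEq (Int.modEq_iff_dvd.2 ⟨-(k ^ 2 + k + l ^ 2) + l, by push_cast; ring⟩)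

theorem jacobi_neg_one_sq (ho : Odd β.norm) : Jac (-1) β ^ 2 = 1 := by
  rw [← jacobi_pow_left ho, neg_one_sq, jacobi_one_left ho]

theorem jacobi_two_sq (ho : Odd β.norm) : Jac 2 β ^ 2 = Jac (-1) β := by
  have hsq : Jac 𝒊 β ^ 2 = Jac (-1) β := by rw [← jacobi_pow_left ho, sqrtd_sq]
  rw [two_eq, jacobi_mul_left ho, jacobi_mul_left ho, jacobi_pow_left ho, mul_pow, mul_pow,
    jacobi_neg_one_sq ho, hsq, ← pow_mul, jacobi_pow_four ho (isCoprime_one_add_sqrtd ho), one_mul,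
    mul_one]

theorem isCoprime_natCast_iff_not_dvd {l : ℕ} (hl : l.Prime) {z : ℤ} :
    IsCoprime z l ↔ ¬ (l : ℤ) ∣ z := by
  rw [isCoprime_comm, (Nat.prime_iff_prime_int.1 hl).irreducible.coprime_iff_not_dvd]

open Polynomial in
theorem isCoprime_eval_of_modEq {f : ℤ[X]} {s t m : ℤ} (h : IsCoprime (f.eval s) m)
    (hst : s ≡ t [ZMOD m]) : IsCoprime (f.eval t) m := by
  obtain ⟨k, hk⟩ := hst.dvd.trans (sub_dvd_eval_sub t s f)
  rw [eq_add_of_sub_eq' hk]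
  exact h.add_mul_left_left k

open Polynomial in
theorem exists_isCoprime_eval (f : ℤ[X]) {M : ℕ} (hM : M ≠ 0)
    (h : ∀ l : ℕ, l.Prime → l ∣ M → ∃ w, ¬ (l : ℤ) ∣ f.eval w) :
    ∃ t, IsCoprime (f.eval t) M := by
  induction M using induction_on_primes with
  | zero => exact absurd rfl hM
  | one => exact ⟨0, by simpa using isCoprime_one_right⟩
  | prime_mul l m hl ih =>
    obtain ⟨t, ht⟩ := ih (right_ne_zero_of_mul hM) fun k hk hkm => h k hk (hkm.mul_left l)
    push_cast
    by_cases hlm : l ∣ m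
    · refine ⟨t, IsCoprime.mul_right (ht.of_isCoprime_of_dvd_right ?_) ht⟩
      exact_mod_cast hlm
    · obtain ⟨w, hw⟩ := h l hl (dvd_mul_right l m)
      obtain ⟨u, hul, hum⟩ : ∃ u, w ≡ u [ZMOD l] ∧ t ≡ u [ZMOD m] := by
        obtain ⟨r, s, hrs⟩ := (isCoprime_natCast_iff_not_dvd hl (z := m)).2 (by exact_mod_cast hlm)
        refine ⟨t * (s * l) + w * (r * m), Int.modEq_iff_dvd.2 ⟨(t - w) * s, ?_⟩,
          Int.modEq_iff_dvd.2 ⟨(w - t) * r, ?_⟩⟩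
        · linear_combination w * hrs
        · linear_combination t * hrs
      exact ⟨u, (isCoprime_eval_of_modEq ((isCoprime_natCast_iff_not_dvd hl).2 hw) hul).mul_right
        (isCoprime_eval_of_modEq ht hum)⟩

end Supplements

/-! ### Resolvents and twists -/

section Resolvent

variable {β γ π ϖ s : GaussianInt} {x V : ℤ}

theorem intCast_norm_eq_mul_star (α : GaussianInt) : (α.norm : GaussianInt) = α * star α := by
  rw [Zsqrtd.norm_eq_mul_conj]

theorem isCoprime_star (h : IsCoprime β γ) : IsCoprime (star β) (star γ) :=
  h.map (starRingEnd GaussianInt)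

theorem isCoprime_of_isCoprime_norm {n : ℤ} (h : IsCoprime n γ.norm) :
    IsCoprime (n : GaussianInt) γ :=
  (isCoprime_intCast h).of_isCoprime_of_dvd_right (dvd_norm γ)

theorem star_jacobi_eq_inv (h : Odd β.norm) (hc : IsCoprime γ β) :
    star (Jac γ β) = (Jac γ β)⁻¹ :=
  eq_inv_of_mul_eq_one_right (jacobi_mul_star_self h hc)

/-- The Hilbert 90 element attached to `π` and `x`: modulo any `β` with `π π̄ ≡ x² [MOD β]` it
satisfies `ρ π̄ ≡ x ρ̄`, so that `π / x` becomes the quotient `ρ / ρ̄`. The parameter `s` is a free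
twist. -/
def resolvent (s : GaussianInt) (x : ℤ) (π : GaussianInt) : GaussianInt := s * x + star s * π

theorem star_resolvent (s : GaussianInt) (x : ℤ) (π : GaussianInt) :
    star (resolvent s x π) = star s * x + s * star π := by
  rw [resolvent, star_add, star_mul', star_mul', star_star, star_intCast]

theorem resolvent_mul_star_sub (s : GaussianInt) (x : ℤ) (π : GaussianInt) :
    resolvent s x π * star π - x * star (resolvent s x π) = (π.norm - x ^ 2) * star s := by
  rw [star_resolvent, resolvent, intCast_norm_eq_mul_star]; ring

theorem norm_resolvent (s : GaussianInt) (x : ℤ) (π : GaussianInt) :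
    (resolvent s x π).norm =
      2 * (x * (star s * resolvent s x π).re) + s.norm * (π.norm - x ^ 2) := by
  simp only [resolvent, norm_eq_sq_add_sq, Zsqrtd.re_add, Zsqrtd.im_add, Zsqrtd.re_mul,
    Zsqrtd.im_mul, Zsqrtd.re_star, Zsqrtd.im_star, Zsqrtd.re_intCast, Zsqrtd.im_intCast]
  ring

theorem jacobi_eq_jacobi_resolvent_mul (ho : Odd β.norm)
    (hd : β ∣ (π.norm : GaussianInt) - x ^ 2) (hx : IsCoprime (x : GaussianInt) β)
    (hc : IsCoprime (resolvent s x π) β.norm) :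
    Jac π β = Jac (resolvent s x π) β.norm * Jac x β := by
  set ρ := resolvent s x π
  have hcs : IsCoprime (star ρ) β := by
    rw [intCast_norm_eq_mul_star] at hc
    simpa using isCoprime_star hc.of_mul_right_right
  have hnorm : Jac ρ β.norm * Jac (star ρ) β = Jac ρ β := by
    rw [jacobi_norm_right (ne_zero_of_odd_norm ho), ← star_star ρ, jacobi_star ho, star_star,
      star_jacobi_eq_inv ho hcs, inv_mul_cancel_right₀ (jacobi_ne_zero ho hcs)]
  have hρ : Jac ρ β * Jac (star π) β = Jac x β * Jac (star ρ) β := by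
    rw [← jacobi_mul_left ho, ← jacobi_mul_left ho]
    refine jacobi_congr ho ?_
    rw [resolvent_mul_star_sub]
    exact hd.mul_right _
  have hπ : Jac π β * Jac (star π) β = Jac x β ^ 2 := by
    rw [← jacobi_mul_left ho, ← jacobi_pow_left ho, ← intCast_norm_eq_mul_star]
    exact jacobi_congr ho hd
  have hx0 := jacobi_ne_zero ho hx
  have hπ0 : Jac (star π) β ≠ 0 := right_ne_zero_of_mul (hπ ▸ pow_ne_zero 2 hx0)
  have hρ0 := jacobi_ne_zero ho hcs
  rw [← mul_left_inj' hπ0, ← mul_left_inj' hρ0]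
  linear_combination Jac (star ρ) β * hπ - Jac x β * Jac (star π) β * hnorm - Jac x β * hρ

theorem jacobi_intCast_eq_jacobi_resolvent_sq {n : ℤ} (hn : Odd n) (hd : n ∣ π.norm - x ^ 2)
    (hx : IsCoprime (x : GaussianInt) n) (hc : IsCoprime (resolvent s x π) n) :
    Jac π n = Jac (resolvent s x π) n ^ 2 := by
  have h0 := intCast_ne_zero_of_odd hn
  have hd' : (n : GaussianInt) ∣ (π.norm : GaussianInt) - x ^ 2 := by
    simpa using map_dvd (Int.castRingHom GaussianInt) hd
  have hnorm : ((n : GaussianInt).norm : GaussianInt) = n * n := by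
    rw [Zsqrtd.norm_intCast, Int.cast_mul]
  rw [jacobi_eq_jacobi_resolvent_mul (odd_norm_intCast hn) hd' hx (hnorm ▸ hc.mul_right hc), hnorm,
    jacobi_mul_right h0 h0, jacobi_intCast_intCast hn hx, mul_one, sq]

theorem jacobi_resolvent_norm (hs : Odd s.norm) (hc : IsCoprime (star s) s) (hx : Jac x s = 1)
    (π : GaussianInt) : Jac (resolvent s x π) s.norm = Jac π s := by
  have h₁ : Jac (resolvent s x π) s = Jac (star s) s * Jac π s := by
    rw [← jacobi_mul_left hs]
    exact jacobi_congr hs ⟨x, by rw [resolvent]; ring⟩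
  have h₂ : Jac (star (resolvent s x π)) s = Jac (star s) s := by
    rw [← mul_one (Jac (star s) s), ← hx, ← jacobi_mul_left hs]
    exact jacobi_congr hs ⟨star π, by rw [star_resolvent]; ring⟩
  rw [jacobi_norm_right (ne_zero_of_odd_norm hs), ← star_star (resolvent s x π), jacobi_star hs,
    star_star, h₁, h₂, mul_right_comm, jacobi_mul_star_self hs hc, one_mul]

theorem jacobi_one_add_sqrtd_mul_intCast {n N : ℤ} (hn : n = 4 * N + 1) (ho : Odd γ.norm)
    (him : Even γ.im) (hc : IsCoprime (n : GaussianInt) γ) :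
    Jac ((1 + 𝒊) * γ) n = I ^ N * Jac n γ := by
  rw [jacobi_mul_left (odd_norm_intCast (odd_of_eq_four_mul_add_one hn)),
    jacobi_one_add_sqrtd_intCast hn, reciprocity ho him (by omega) hc.symm]

theorem jacobi_sqrtd_mul_intCast {n N : ℤ} (hn : n = 4 * N + 1) (ho : Odd ϖ.norm)
    (him : Even ϖ.im) (hc : IsCoprime (n : GaussianInt) ϖ) :
    Jac (𝒊 * ϖ) n = I ^ (2 * N) * Jac n ϖ := by
  rw [jacobi_mul_left (odd_norm_intCast (odd_of_eq_four_mul_add_one hn)),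
    jacobi_sqrtd_intCast hn, reciprocity ho him (by omega) hc.symm]

/-- The twist `s` used in `resolvent`. It is congruent to `1` modulo `8`, and modulo every
divisor of `V`. -/
def twist (V : ℤ) : GaussianInt := ⟨1, 8 * V⟩

theorem twist_eq (V : ℤ) : twist V = 1 + 8 * V * 𝒊 := by
  rw [eq_re_add_im_mul_sqrtd (twist V)]; simp [twist]

theorem norm_twist (V : ℤ) : (twist V).norm = 4 * (4 * (4 * V ^ 2)) + 1 := by
  rw [norm_eq_sq_add_sq, twist]; ring

theorem odd_norm_twist (V : ℤ) : Odd (twist V).norm :=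
  odd_of_eq_four_mul_add_one (norm_twist V)

theorem even_im_twist (V : ℤ) : Even (twist V).im := ⟨4 * V, by rw [twist]; ring⟩

theorem star_twist (V : ℤ) : star (twist V) = 2 - twist V := by
  rw [twist]; ext <;> simp

theorem isCoprime_star_twist (V : ℤ) : IsCoprime (star (twist V)) (twist V) := by
  rw [star_twist, show 2 - twist V = 2 + twist V * (-1) by ring]
  exact (isCoprime_two (odd_norm_twist V)).add_mul_left_left _

theorem jacobi_two_twist (V : ℤ) : Jac 2 (twist V) = 1 := by
  rw [jacobi_two (k := 0) (l := 2 * V) rfl (by rw [twist]; ring) isCoprime_one_left, ← mul_assoc]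
  exact I_zpow_four_mul V

theorem isCoprime_norm_twist {V : ℤ} (hV : x ∣ V) : IsCoprime x (twist V).norm := by
  obtain ⟨t, rfl⟩ := hV
  exact ⟨-(64 * x * t ^ 2), 1, by rw [norm_twist]; ring⟩

theorem jacobi_intCast_twist {X V : ℤ} (hx : x = 4 * X + 1) (hV : x ∣ V) :
    Jac x (twist V) = 1 := by
  have hc := isCoprime_of_isCoprime_norm (isCoprime_norm_twist hV)
  have hxo := odd_norm_intCast (odd_of_eq_four_mul_add_one hx)
  obtain ⟨t, rfl⟩ := hV
  rw [reciprocity (odd_norm_twist _) (even_im_twist _) (by omega) hc.symm,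
    jacobi_congr hxo (α' := 1) ⟨8 * t * 𝒊, by rw [twist_eq]; push_cast; ring⟩, jacobi_one_left hxo]

/-- The integer `Re (s̄ ρ)`, where `s = twist V` and `ρ` is the resolvent of `𝒊 ϖ` and `x`. -/
def twistedTrace (V x : ℤ) (ϖ : GaussianInt) : ℤ :=
  (star (twist V) * resolvent (twist V) x (𝒊 * ϖ)).re

theorem twistedTrace_eq (V x : ℤ) (ϖ : GaussianInt) :
    twistedTrace V x ϖ = x - ϖ.im + 16 * V * ϖ.re + 64 * V ^ 2 * (x + ϖ.im) := by
  simp only [twistedTrace, resolvent, twist, Zsqrtd.re_add, Zsqrtd.im_add, Zsqrtd.re_mul,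
    Zsqrtd.im_mul, Zsqrtd.re_star, Zsqrtd.im_star, Zsqrtd.re_intCast, Zsqrtd.im_intCast,
    Zsqrtd.re_sqrtd, Zsqrtd.im_sqrtd]
  ring

theorem twist_dvd_twistedTrace_sub (V x : ℤ) (ϖ : GaussianInt) :
    twist V ∣ (twistedTrace V x ϖ : GaussianInt) - 2 * (𝒊 * ϖ) := by
  refine ⟨star (twist V) * (x + ϖ.im) - 2 * ϖ.re * 𝒊, ?_⟩
  rw [twistedTrace_eq, star_twist, twist_eq]
  push_cast
  linear_combination -2 * 𝒊 * eq_re_add_im_mul_sqrtd ϖ +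
    (-2 * ϖ.im + 16 * V * ϖ.re + 64 * V ^ 2 * (x + ϖ.im)) * sqrtd_sq

theorem jacobi_twist_twistedTrace {V H : ℤ} (hH : twistedTrace V x ϖ = 4 * H + 1)
    (hc : IsCoprime (twist V) (twistedTrace V x ϖ)) :
    Jac (twist V) (twistedTrace V x ϖ) = Jac (𝒊 * ϖ) (twist V) := by
  have ho := odd_norm_twist V
  rw [← reciprocity ho (even_im_twist V) (by omega) hc,
    jacobi_congr ho (twist_dvd_twistedTrace_sub V x ϖ), jacobi_mul_left ho, jacobi_two_twist,
    one_mul]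

theorem isCoprime_twist_of_isCoprime_twistedTrace
    (hc : IsCoprime (twistedTrace V x ϖ : GaussianInt) ϖ) :
    IsCoprime (twist V) (twistedTrace V x ϖ) := by
  obtain ⟨w, hw⟩ := twist_dvd_twistedTrace_sub V x ϖ
  have h₂ : IsCoprime (twist V) 2 := (isCoprime_two (odd_norm_twist V)).symm
  have hϖ : IsCoprime (twist V) ϖ := by
    obtain ⟨α, β, hαβ⟩ := hc
    exact ⟨α * w, 2 * α * 𝒊 + β, by linear_combination hαβ - α * hw⟩
  rw [sub_eq_iff_eq_add'.1 hw, ← mul_assoc]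
  exact ((h₂.mul_right (isCoprime_one_right.of_isCoprime_of_dvd_right isUnit_sqrtd.dvd)).mul_right
    hϖ).add_mul_left_right w

theorem jacobi_intCast_of_resolvent_eq {X : ℤ} (hx : x = 4 * X + 1) (hV : x ∣ V)
    (hγ : resolvent (twist V) x (𝒊 * ϖ) = (1 + 𝒊) * γ) (ho : Odd γ.norm) (him : Even γ.im)
    (hϖo : Odd ϖ.norm) (hϖim : Even ϖ.im) (hcγ : IsCoprime (x : GaussianInt) γ)
    (hcϖ : IsCoprime (x : GaussianInt) ϖ) : Jac x γ = I ^ X * Jac x ϖ := by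
  refine mul_left_cancel₀ (zpow_ne_zero X Complex.I_ne_zero) ?_
  rw [← jacobi_one_add_sqrtd_mul_intCast hx ho him hcγ, ← mul_assoc,
    ← zpow_add₀ Complex.I_ne_zero, ← two_mul, ← jacobi_sqrtd_mul_intCast hx hϖo hϖim hcϖ, ← hγ]
  obtain ⟨t, rfl⟩ := hV
  refine jacobi_congr (odd_norm_intCast (odd_of_eq_four_mul_add_one hx))
    ⟨twist (x * t) - 8 * t * 𝒊 * (𝒊 * ϖ), ?_⟩
  rw [resolvent, star_twist, twist_eq]; push_cast; ring

theorem jacobi_norm_twist_of_resolvent_eq {X : ℤ} (hx : x = 4 * X + 1) (hV : x ∣ V)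
    (hγ : resolvent (twist V) x (𝒊 * ϖ) = (1 + 𝒊) * γ) (ho : Odd γ.norm) (him : Even γ.im)
    (hc : IsCoprime ((twist V).norm : GaussianInt) γ) :
    Jac (twist V).norm γ = Jac (𝒊 * ϖ) (twist V) := by
  rw [← jacobi_resolvent_norm (odd_norm_twist V) (isCoprime_star_twist V)
    (jacobi_intCast_twist hx hV), hγ, jacobi_one_add_sqrtd_mul_intCast (norm_twist V) ho him hc,
    I_zpow_four_mul, one_mul]

theorem jacobi_twistedTrace_of_resolvent_eq {H : ℤ} (hH : twistedTrace V x ϖ = 4 * H + 1)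
    (hγ : resolvent (twist V) x (𝒊 * ϖ) = (1 + 𝒊) * γ) (ho : Odd γ.norm) (him : Even γ.im)
    (hcγ : IsCoprime (twistedTrace V x ϖ : GaussianInt) γ)
    (hcϖ : IsCoprime (twistedTrace V x ϖ : GaussianInt) ϖ) :
    Jac (twistedTrace V x ϖ) γ = I ^ H * Jac (𝒊 * ϖ) (twist V) := by
  set h := twistedTrace V x ϖ
  have hho := odd_norm_intCast (odd_of_eq_four_mul_add_one hH)
  have hcs := isCoprime_twist_of_isCoprime_twistedTrace hcϖ
  have hcs' : IsCoprime (star (twist V)) h := by simpa using isCoprime_star hcs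
  obtain ⟨α, hα⟩ : ∃ α, α = star (twist V) * ((1 + 𝒊) * γ) := ⟨_, rfl⟩
  have hre : α.re = h := by rw [hα, ← hγ]; rfl
  have hcα : IsCoprime α h := by
    rw [hα]
    exact hcs'.mul_left ((isCoprime_one_add_sqrtd hho).mul_left hcγ.symm)
  have h₁ : Jac α h = I ^ (2 * H) := by
    rw [← hre] at hH hcα ⊢
    exact jacobi_self_re hH hcα
  rw [hα, jacobi_mul_left hho, jacobi_one_add_sqrtd_mul_intCast hH ho him hcγ] at h₁
  have h₂ : Jac (star (twist V)) h = star (Jac (𝒊 * ϖ) (twist V)) := by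
    rw [← jacobi_twist_twistedTrace hH hcs, ← jacobi_star hho, star_intCast]
  have h₃ : Jac (𝒊 * ϖ) (twist V) * star (Jac (𝒊 * ϖ) (twist V)) = 1 := by
    rw [← jacobi_twist_twistedTrace hH hcs]
    exact jacobi_mul_star_self hho hcs
  rw [h₂, two_mul, zpow_add₀ Complex.I_ne_zero] at h₁
  refine mul_left_cancel₀ (zpow_ne_zero H Complex.I_ne_zero) ?_
  linear_combination Jac (𝒊 * ϖ) (twist V) * h₁ - I ^ H * Jac h γ * h₃

end Resolvent

/-! ### Descent -/

theorem isCoprime_of_sq_lt {p : ℕ} (hp : p.Prime) {z : ℤ} (h0 : z ≠ 0) (h : z ^ 2 < p) :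
    IsCoprime z p := by
  rw [isCoprime_natCast_iff_not_dvd hp]
  intro hd
  have := Int.le_of_dvd (by positivity) (hd.trans (dvd_pow_self z two_ne_zero))
  omega

theorem natCast_prime_ne_sq {p : ℕ} (hp : p.Prime) (z : ℤ) : (p : ℤ) ≠ z ^ 2 := by
  intro h
  have hp' := Nat.prime_iff_prime_int.1 hp
  rw [h] at hp'
  exact not_prime_pow (by norm_num) hp'

/-- Two representations `p = N(ϖ) = x² + 2 Q y²` of a prime, with the signs and parities of the
coordinates normalised. The variables `C`, `E`, `X`, `Y`, `q` name the resulting quotients. -/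
structure TwoRepresentations (p : ℕ) (ϖ : GaussianInt) (x y Q C E X Y q : ℤ) : Prop where
  prime : p.Prime
  norm_eq : ϖ.norm = p
  eq_add : (p : ℤ) = x ^ 2 + 2 * (Q * y ^ 2)
  re_eq : ϖ.re = 4 * C + 1
  im_eq : ϖ.im = 4 * E
  x_eq : x = 4 * X + 1
  y_eq : y = 2 * Y
  Q_eq : Q = 4 * q + 1
  Q_pos : 0 < Q

namespace TwoRepresentations

variable {p : ℕ} {ϖ : GaussianInt} {x y Q C E X Y q : ℤ}

theorem y_ne_zero (h : TwoRepresentations p ϖ x y Q C E X Y q) : y ≠ 0 := by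
  rintro rfl
  exact natCast_prime_ne_sq h.prime x (by rw [h.eq_add]; ring)

theorem x_ne_zero (h : TwoRepresentations p ϖ x y Q C E X Y q) : x ≠ 0 := by
  have := h.x_eq
  omega

theorem isCoprime_x_p (h : TwoRepresentations p ϖ x y Q C E X Y q) : IsCoprime x p := by
  have hy := h.y_ne_zero
  have hQ := h.Q_pos
  have : 0 < Q * y ^ 2 := by positivity
  exact isCoprime_of_sq_lt h.prime h.x_ne_zero (by linarith [h.eq_add])

theorem isCoprime_y_p (h : TwoRepresentations p ϖ x y Q C E X Y q) : IsCoprime y p := by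
  have hx := h.x_ne_zero
  have : 0 < x ^ 2 := by positivity
  have : y ^ 2 ≤ Q * y ^ 2 := le_mul_of_one_le_left (sq_nonneg y) h.Q_pos
  exact isCoprime_of_sq_lt h.prime h.y_ne_zero (by linarith [h.eq_add, sq_nonneg y])

theorem isCoprime_x_Q_mul_y_sq (h : TwoRepresentations p ϖ x y Q C E X Y q) :
    IsCoprime x (Q * y ^ 2) := by
  have := h.isCoprime_x_p
  rw [h.eq_add, sq, IsCoprime.mul_add_left_right_iff] at this
  exact this.of_mul_right_right

theorem isCoprime_x_Q (h : TwoRepresentations p ϖ x y Q C E X Y q) : IsCoprime x Q :=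
  h.isCoprime_x_Q_mul_y_sq.of_mul_right_left

theorem isCoprime_x_y (h : TwoRepresentations p ϖ x y Q C E X Y q) : IsCoprime x y :=
  (IsCoprime.pow_right_iff two_pos).1 h.isCoprime_x_Q_mul_y_sq.of_mul_right_right

theorem isCoprime_re_im (h : TwoRepresentations p ϖ x y Q C E X Y q) : IsCoprime ϖ.re ϖ.im := by
  rw [Int.isCoprime_iff_gcd_eq_one, ← Nat.isUnit_iff]
  refine (Nat.prime_iff.1 h.prime).irreducible.squarefree _ ?_
  zify
  rw [← h.norm_eq, norm_eq_sq_add_sq, sq, sq]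
  exact dvd_add (mul_dvd_mul (Int.gcd_dvd_left ..) (Int.gcd_dvd_left ..))
    (mul_dvd_mul (Int.gcd_dvd_right ..) (Int.gcd_dvd_right ..))

theorem odd_norm (h : TwoRepresentations p ϖ x y Q C E X Y q) : Odd ϖ.norm :=
  odd_norm_of_re_im (k := 2 * C) (l := 2 * E) (by rw [h.re_eq]; ring) (by rw [h.im_eq]; ring)

theorem even_im (h : TwoRepresentations p ϖ x y Q C E X Y q) : Even ϖ.im :=
  ⟨2 * E, by rw [h.im_eq]; ring⟩

theorem isCoprime_p (h : TwoRepresentations p ϖ x y Q C E X Y q) {n : ℤ}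
    (hn : IsCoprime n p) : IsCoprime (n : GaussianInt) ϖ :=
  isCoprime_of_isCoprime_norm (h.norm_eq ▸ hn)

end TwoRepresentations

/-- The descent data for `TwoRepresentations`: a multiple `V` of `x` for which the resolvent of
`𝒊 ϖ` and `x` twisted by `V` is `(1 + 𝒊) γ`, and `twistedTrace V x ϖ` is prime to `Q y p`. -/
structure Descent (p : ℕ) (ϖ : GaussianInt) (x y Q C E X Y q V : ℤ) (γ : GaussianInt) : Prop
    extends TwoRepresentations p ϖ x y Q C E X Y q where
  x_dvd : x ∣ V
  isCoprime_trace : IsCoprime (twistedTrace V x ϖ) (Q * y * p)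
  resolvent_eq : resolvent (twist V) x (𝒊 * ϖ) = (1 + 𝒊) * γ
  even_im_γ : Even γ.im

namespace TwoRepresentations

variable {p : ℕ} {ϖ : GaussianInt} {x y Q C E X Y q : ℤ}

theorem isCoprime_two_x_sub_im (h : TwoRepresentations p ϖ x y Q C E X Y q) :
    IsCoprime 2 (x - ϖ.im) :=
  ⟨-2 * (X - E), 1, by rw [h.x_eq, h.im_eq]; ring⟩

theorem exists_isCoprime_twistedTrace (h : TwoRepresentations p ϖ x y Q C E X Y q) :
    ∃ t, IsCoprime (twistedTrace (x * t) x ϖ) (Q * y * p) := by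
  let f : Polynomial ℤ := .C (x - ϖ.im) + .C (16 * x * ϖ.re) * .X +
    .C (64 * x ^ 2 * (x + ϖ.im)) * .X ^ 2
  have hf (t : ℤ) : f.eval t = twistedTrace (x * t) x ϖ := by
    simp only [f, twistedTrace_eq, Polynomial.eval_add, Polynomial.eval_mul, Polynomial.eval_C,
      Polynomial.eval_X, Polynomial.eval_pow]
    ring
  have hM : (Q * y * p).natAbs ≠ 0 := Int.natAbs_ne_zero.2
    (mul_ne_zero (mul_ne_zero h.Q_pos.ne' h.y_ne_zero) (by exact_mod_cast h.prime.ne_zero))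
  suffices hloc : ∀ l : ℕ, l.Prime → l ∣ (Q * y * p).natAbs → ∃ w, ¬ (l : ℤ) ∣ f.eval w by
    obtain ⟨t, ht⟩ := exists_isCoprime_eval f hM hloc
    rw [hf, Int.natCast_natAbs, IsCoprime.abs_right_iff] at ht
    exact ⟨t, ht⟩
  intro l hl hlM
  by_contra! hdvd
  simp only [hf, twistedTrace_eq] at hdvd
  have h₀ : (l : ℤ) ∣ x - ϖ.im := by simpa using hdvd 0
  have hx : IsCoprime x l := ((h.isCoprime_x_Q.mul_right h.isCoprime_x_y).mul_right
    h.isCoprime_x_p).of_isCoprime_of_dvd_right (Int.natCast_dvd.2 hlM)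
  have h₂ : IsCoprime 2 (l : ℤ) := h.isCoprime_two_x_sub_im.of_isCoprime_of_dvd_right h₀
  -- `l` would divide `f 1 + f (-1) - 2 f 0 + 128 x² f 0 = 2⁸ x³`.
  refine (isCoprime_natCast_iff_not_dvd hl).1 ((h₂.pow_left (m := 8)).mul_left
    (hx.pow_left (m := 3))) ?_
  exact (dvd_add (dvd_add (hdvd 1) (hdvd (-1))) (h₀.mul_left (128 * x ^ 2 - 2))).trans
    (dvd_of_eq (by ring))

theorem exists_descent (h : TwoRepresentations p ϖ x y Q C E X Y q) :
    ∃ V γ, Descent p ϖ x y Q C E X Y q V γ := by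
  obtain ⟨t, ht⟩ := h.exists_isCoprime_twistedTrace
  set V := x * t
  refine ⟨V, ⟨1 + 2 * X + 2 * C - 2 * E + 4 * V * (ϖ.re + x + ϖ.im),
    2 * C - 2 * X + 2 * E + 4 * V * (x + ϖ.im - ϖ.re)⟩, h, dvd_mul_right x t, ht, ?_,
    ⟨C - X + E + 2 * V * (x + ϖ.im - ϖ.re), by ring⟩⟩
  ext <;> simp only [resolvent, twist, Zsqrtd.re_add, Zsqrtd.im_add, Zsqrtd.re_mul,
    Zsqrtd.im_mul, Zsqrtd.re_star, Zsqrtd.im_star, Zsqrtd.re_intCast, Zsqrtd.im_intCast,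
    Zsqrtd.re_sqrtd, Zsqrtd.im_sqrtd, Zsqrtd.re_one, Zsqrtd.im_one]
  · linear_combination h.x_eq - h.im_eq
  · linear_combination h.re_eq

end TwoRepresentations

theorem exists_eq_sign_mul_two_pow_mul {y : ℤ} (hy : y ≠ 0) :
    ∃ (ε : ℤ) (k : ℕ) (N : ℤ), (ε = 1 ∨ ε = -1) ∧ y = ε * (2 ^ k * (4 * N + 1)) := by
  obtain ⟨k, w, ⟨j, rfl⟩, hkw⟩ := Nat.exists_eq_two_pow_mul_odd (Int.natAbs_ne_zero.2 hy)
  obtain ⟨ε, hε, hy⟩ : ∃ ε : ℤ, (ε = 1 ∨ ε = -1) ∧ y = ε * (2 ^ k * (2 * j + 1)) := by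
    obtain h | h := Int.natAbs_eq y
    · exact ⟨1, .inl rfl, by rw [h, hkw]; push_cast; ring⟩
    · exact ⟨-1, .inr rfl, by rw [h, hkw]; push_cast; ring⟩
  obtain ⟨i, rfl | rfl⟩ := Nat.even_or_odd' j
  · exact ⟨ε, k, i, hε, by rw [hy]; push_cast; ring⟩
  · exact ⟨-ε, k, -(i + 1), by omega, by rw [hy]; push_cast; ring⟩

theorem I_zpow_two_mul_pow {Y N ε : ℤ} {k : ℕ} (hε : ε = 1 ∨ ε = -1)
    (hY : 2 * Y = ε * (2 ^ k * (4 * N + 1))) : (I ^ (2 * Y)) ^ k = I ^ (2 * Y) := by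
  rw [← zpow_natCast, ← zpow_mul]
  refine I_zpow_eq_of_modEq (Int.modEq_iff_dvd.2 ?_)
  match k, hY with
  | 0, hY => obtain rfl | rfl := hε <;> omega
  | 1, _ => simp
  | k + 2, hY =>
    exact ⟨ε * (2 ^ k * (4 * N + 1)) * (1 - (k + 2 : ℕ)), by rw [hY]; ring⟩

theorem isCoprime_of_isCoprime_intCast {m n : ℤ} (h : IsCoprime (m : GaussianInt) n) :
    IsCoprime m n := by
  obtain ⟨α, β, hαβ⟩ := h
  exact ⟨α.re, β.re, by simpa using congrArg Zsqrtd.re hαβ⟩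

namespace Descent

variable {p : ℕ} {ϖ γ : GaussianInt} {x y Q C E X Y q V : ℤ}

theorem trace_eq (h : Descent p ϖ x y Q C E X Y q V γ) : twistedTrace V x ϖ =
    4 * (X - E + 4 * V * ϖ.re + 16 * V ^ 2 * (x + ϖ.im)) + 1 := by
  rw [twistedTrace_eq]; linear_combination h.x_eq - h.im_eq

theorem norm_γ (h : Descent p ϖ x y Q C E X Y q V γ) :
    γ.norm = x * twistedTrace V x ϖ + (twist V).norm * (Q * y ^ 2) := by
  have hN := norm_resolvent (twist V) x (𝒊 * ϖ)
  have hI : (𝒊 : GaussianInt).norm = 1 := rfl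
  have hI₁ : (1 + 𝒊 : GaussianInt).norm = 2 := rfl
  rw [← twistedTrace, h.resolvent_eq, Zsqrtd.norm_mul, Zsqrtd.norm_mul, hI, hI₁, one_mul,
    h.norm_eq, h.eq_add] at hN
  linarith

theorem isCoprime_trace_Q (h : Descent p ϖ x y Q C E X Y q V γ) :
    IsCoprime (twistedTrace V x ϖ) Q := h.isCoprime_trace.of_mul_right_left.of_mul_right_left

theorem isCoprime_trace_y (h : Descent p ϖ x y Q C E X Y q V γ) :
    IsCoprime (twistedTrace V x ϖ) y := h.isCoprime_trace.of_mul_right_left.of_mul_right_right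

theorem isCoprime_trace_ϖ (h : Descent p ϖ x y Q C E X Y q V γ) :
    IsCoprime (twistedTrace V x ϖ : GaussianInt) ϖ :=
  h.isCoprime_p h.isCoprime_trace.of_mul_right_right

theorem isCoprime_trace_norm_twist (h : Descent p ϖ x y Q C E X Y q V γ) :
    IsCoprime (twistedTrace V x ϖ) (twist V).norm := by
  have hc := isCoprime_twist_of_isCoprime_twistedTrace h.isCoprime_trace_ϖ
  refine isCoprime_of_isCoprime_intCast ?_
  rw [intCast_norm_eq_mul_star]
  exact hc.symm.mul_right (by simpa using (isCoprime_star hc).symm)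

theorem isCoprime_x_γ (h : Descent p ϖ x y Q C E X Y q V γ) :
    IsCoprime (x : GaussianInt) γ := by
  refine isCoprime_of_isCoprime_norm ?_
  rw [h.norm_γ, IsCoprime.mul_add_left_right_iff]
  exact (isCoprime_norm_twist h.x_dvd).mul_right h.isCoprime_x_Q_mul_y_sq

theorem isCoprime_trace_γ (h : Descent p ϖ x y Q C E X Y q V γ) :
    IsCoprime (twistedTrace V x ϖ : GaussianInt) γ := by
  refine isCoprime_of_isCoprime_norm ?_
  rw [h.norm_γ, IsCoprime.mul_add_right_right_iff]
  exact h.isCoprime_trace_norm_twist.mul_right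
    (h.isCoprime_trace_Q.mul_right h.isCoprime_trace_y.pow_right)

theorem isCoprime_norm_twist_γ (h : Descent p ϖ x y Q C E X Y q V γ) :
    IsCoprime ((twist V).norm : GaussianInt) γ := by
  refine isCoprime_of_isCoprime_norm ?_
  rw [h.norm_γ, IsCoprime.add_mul_left_right_iff]
  exact (isCoprime_norm_twist h.x_dvd).symm.mul_right h.isCoprime_trace_norm_twist.symm

theorem isCoprime_Q_γ (h : Descent p ϖ x y Q C E X Y q V γ) :
    IsCoprime (Q : GaussianInt) γ := by
  refine isCoprime_of_isCoprime_norm ?_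
  rw [h.norm_γ, mul_left_comm, IsCoprime.add_mul_left_right_iff]
  exact h.isCoprime_x_Q.symm.mul_right h.isCoprime_trace_Q.symm

theorem isCoprime_y_γ (h : Descent p ϖ x y Q C E X Y q V γ) :
    IsCoprime (y : GaussianInt) γ := by
  refine isCoprime_of_isCoprime_norm ?_
  rw [h.norm_γ, show (twist V).norm * (Q * y ^ 2) = y * ((twist V).norm * Q * y) by ring,
    IsCoprime.add_mul_left_right_iff]
  exact h.isCoprime_x_y.symm.mul_right h.isCoprime_trace_y.symm

theorem exists_norm_γ_eq (h : Descent p ϖ x y Q C E X Y q V γ) :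
    ∃ e, γ.norm = 4 * e + 1 ∧ 2 * e ≡ 2 * (E + Y) [ZMOD 4] := by
  obtain ⟨m, hm⟩ := (Int.even_mul_pred_self Y).two_dvd
  set H := X - E + 4 * V * ϖ.re + 16 * V ^ 2 * (x + ϖ.im)
  refine ⟨4 * X * H + X + H + (twist V).norm * Q * Y ^ 2, ?_, Int.modEq_iff_dvd.2
    ⟨E - X - 2 * X * H - 2 * V * ϖ.re - 8 * V ^ 2 * (x + ϖ.im)
      - (q + 16 * V ^ 2 * (4 * q + 1)) * (2 * Y ^ 2) - m, ?_⟩⟩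
  · rw [h.norm_γ, h.trace_eq]
    linear_combination (4 * H + 1) * h.x_eq + (twist V).norm * Q * (y + 2 * Y) * h.y_eq
  · rw [norm_twist, h.Q_eq]
    linear_combination -2 * hm

theorem odd_norm_γ (h : Descent p ϖ x y Q C E X Y q V γ) : Odd γ.norm := by
  obtain ⟨e, he, -⟩ := h.exists_norm_γ_eq
  exact odd_of_eq_four_mul_add_one he

theorem jacobi_neg_one_γ (h : Descent p ϖ x y Q C E X Y q V γ) :
    Jac (-1) γ = I ^ (2 * (E + Y)) := by
  obtain ⟨e, he, hmod⟩ := h.exists_norm_γ_eq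
  rw [jacobi_neg_one he, neg_one_zpow_eq]
  exact I_zpow_eq_of_modEq hmod

theorem jacobi_two_γ_sq (h : Descent p ϖ x y Q C E X Y q V γ) :
    Jac 2 γ ^ 2 = I ^ (2 * Y) * Jac 2 ϖ := by
  rw [jacobi_two_sq h.odd_norm_γ, h.jacobi_neg_one_γ,
    jacobi_two h.re_eq h.im_eq h.isCoprime_re_im, ← zpow_add₀ Complex.I_ne_zero]
  congr 1; ring

theorem jacobi_γ_sq_of_dvd_y (h : Descent p ϖ x y Q C E X Y q V γ) {n N : ℤ}
    (hn : n = 4 * N + 1) (hd : n ∣ y) : Jac n γ ^ 2 = Jac n ϖ := by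
  have hd' : (n : GaussianInt) ∣ y := map_dvd (Int.castRingHom GaussianInt) hd
  have hcγ := h.isCoprime_y_γ.of_isCoprime_of_dvd_left hd'
  have hcϖ := (h.isCoprime_p h.isCoprime_y_p).of_isCoprime_of_dvd_left hd'
  have hno := odd_of_eq_four_mul_add_one hn
  have hres := jacobi_intCast_eq_jacobi_resolvent_sq (s := twist V) (π := 𝒊 * ϖ) (x := x) hno
    (hd.trans ⟨2 * (Q * y), by
      rw [Zsqrtd.norm_mul, show (𝒊 : GaussianInt).norm = 1 from rfl, h.norm_eq, h.eq_add]; ring⟩)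
    (isCoprime_intCast (h.isCoprime_x_y.of_isCoprime_of_dvd_right hd))
    (by rw [h.resolvent_eq]
        exact (isCoprime_one_add_sqrtd (odd_norm_intCast hno)).mul_left hcγ.symm)
  rw [jacobi_sqrtd_mul_intCast hn h.odd_norm h.even_im hcϖ, h.resolvent_eq,
    jacobi_one_add_sqrtd_mul_intCast hn h.odd_norm_γ h.even_im_γ hcγ, mul_pow, ← zpow_natCast,
    ← zpow_mul, mul_comm N] at hres
  exact (mul_left_cancel₀ (zpow_ne_zero _ Complex.I_ne_zero) hres).symm

theorem jacobi_y_γ_sq (h : Descent p ϖ x y Q C E X Y q V γ) :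
    Jac y γ ^ 2 = I ^ (2 * Y) * Jac y ϖ := by
  have ho := h.odd_norm_γ
  have hϖo := h.odd_norm
  obtain ⟨ε, k, N, hε, hy⟩ := exists_eq_sign_mul_two_pow_mul h.y_ne_zero
  obtain ⟨n, hn⟩ : ∃ n, n = 4 * N + 1 := ⟨_, rfl⟩
  have hnJ := h.jacobi_γ_sq_of_dvd_y hn ⟨ε * 2 ^ k, by rw [hy, hn]; ring⟩
  have hεJ : Jac ε γ ^ 2 = 1 ∧ Jac ε ϖ = 1 := by
    obtain rfl | rfl := hε
    · simp [jacobi_one_left ho, jacobi_one_left hϖo]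
    · simp [jacobi_neg_one_sq ho, jacobi_neg_one_of_four_dvd_im h.re_eq h.im_eq]
  have hk := I_zpow_two_mul_pow hε (h.y_eq ▸ hy)
  rw [← hn] at hy
  have hJ {α : GaussianInt} (hα : Odd α.norm) : Jac y α = Jac ε α * (Jac 2 α ^ k * Jac n α) := by
    rw [← jacobi_pow_left hα, ← jacobi_mul_left hα, ← jacobi_mul_left hα, hy]; push_cast; rfl
  rw [hJ ho, hJ hϖo, mul_pow, mul_pow, ← pow_mul, mul_comm k, pow_mul, h.jacobi_two_γ_sq, hnJ,
    hεJ.1, hεJ.2, mul_pow, hk]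
  ring

theorem jacobi_Q_γ_mul (h : Descent p ϖ x y Q C E X Y q V γ) :
    Jac Q γ * Jac y ϖ = I ^ (E + 2 * X) * Jac x ϖ := by
  have ho := h.odd_norm_γ
  have hx := jacobi_intCast_of_resolvent_eq h.x_eq h.x_dvd h.resolvent_eq ho h.even_im_γ h.odd_norm
    h.even_im h.isCoprime_x_γ (h.isCoprime_p h.isCoprime_x_p)
  have hS := jacobi_norm_twist_of_resolvent_eq h.x_eq h.x_dvd h.resolvent_eq ho h.even_im_γ
    h.isCoprime_norm_twist_γ
  have ht := jacobi_twistedTrace_of_resolvent_eq h.trace_eq h.resolvent_eq ho h.even_im_γ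
    h.isCoprime_trace_γ h.isCoprime_trace_ϖ
  have hS0 := jacobi_ne_zero ho h.isCoprime_norm_twist_γ
  have key : Jac (twist V).norm γ * (Jac Q γ * Jac y γ ^ 2) =
      Jac (-1) γ * (Jac x γ * Jac (twistedTrace V x ϖ) γ) := by
    rw [← jacobi_pow_left ho]
    simp only [← jacobi_mul_left ho]
    refine jacobi_congr ho ((dvd_norm γ).trans (dvd_of_eq ?_))
    rw [h.norm_γ]; push_cast; ring
  rw [ht, ← hS, h.jacobi_y_γ_sq, h.jacobi_neg_one_γ, hx] at key
  have hexp : I ^ (2 * (E + Y)) * I ^ X * I ^ (X - E + 4 * V * ϖ.re + 16 * V ^ 2 * (x + ϖ.im)) =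
      I ^ (2 * Y) * I ^ (E + 2 * X) := by
    simp only [← zpow_add₀ Complex.I_ne_zero]
    exact I_zpow_eq_of_modEq
      (Int.modEq_iff_dvd.2 ⟨-V * ϖ.re - 4 * V ^ 2 * (x + ϖ.im), by ring⟩)
  refine mul_left_cancel₀ (mul_ne_zero hS0 (zpow_ne_zero (2 * Y) Complex.I_ne_zero)) ?_
  linear_combination key + Jac (twist V).norm γ * Jac x ϖ * hexp

end Descent

theorem TwoRepresentations.jacobi_mul {p : ℕ} {ϖ β : GaussianInt} {x y Q C E X Y q : ℤ}
    (h : TwoRepresentations p ϖ x y Q C E X Y q) (hβ : β.norm = Q) :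
    Jac (𝒊 * ϖ) β * Jac y ϖ = Jac x β * I ^ (q + E + 2 * X) * Jac x ϖ := by
  obtain ⟨V, γ, hγ⟩ := h.exists_descent
  have hQo := odd_of_eq_four_mul_add_one h.Q_eq
  have hd : β ∣ ((𝒊 * ϖ).norm : GaussianInt) - x ^ 2 := by
    refine (hβ ▸ dvd_norm β : β ∣ (Q : GaussianInt)).trans ⟨2 * y ^ 2, ?_⟩
    rw [Zsqrtd.norm_mul, show (𝒊 : GaussianInt).norm = 1 from rfl, h.norm_eq, h.eq_add]
    push_cast; ring
  have hc : IsCoprime (resolvent (twist V) x (𝒊 * ϖ)) (Q : GaussianInt) := by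
    rw [hγ.resolvent_eq]
    exact (isCoprime_one_add_sqrtd (odd_norm_intCast hQo)).mul_left hγ.isCoprime_Q_γ.symm
  rw [jacobi_eq_jacobi_resolvent_mul (hβ ▸ hQo) hd
    (isCoprime_of_isCoprime_norm (hβ ▸ h.isCoprime_x_Q)) (hβ ▸ hc), hβ, hγ.resolvent_eq,
    jacobi_one_add_sqrtd_mul_intCast h.Q_eq hγ.odd_norm_γ hγ.even_im_γ hγ.isCoprime_Q_γ,
    add_assoc, zpow_add₀ Complex.I_ne_zero]
  linear_combination I ^ q * Jac x β * hγ.jacobi_Q_γ_mul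

/-! ### The symbols modulo `ϖ` and modulo `β` -/

section Comparison

variable {α β : GaussianInt}

theorem zpow_eq_zpow_iff_modEq_four {K : Type*} [Field K] {w : K} (h : w ^ 2 = -1)
    (h2 : (2 : K) ≠ 0) {m n : ℤ} : w ^ m = w ^ n ↔ m ≡ n [ZMOD 4] := by
  have hw : w ≠ 0 := by rintro rfl; simp at h
  lift w to Kˣ using hw.isUnit
  have horder : orderOf w = 2 ^ 2 := by
    refine orderOf_eq_prime_pow (fun h1 => h2 ?_) (Units.ext ?_)
    · have := congrArg Units.val h1
      push_cast [pow_one] at this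
      linear_combination h - this
    · push_cast
      linear_combination ((w : K) ^ 2 - 1) * h
  have := zpow_eq_zpow_iff_modEq (x := w) (m := m) (n := n)
  rw [horder, Nat.cast_pow, Nat.cast_ofNat, show (2 : ℤ) ^ 2 = 4 by norm_num] at this
  rw [← this]
  norm_cast

theorem jacobiSymbolRat_div {β : GaussianInt} (ho : Odd β.norm) {n x : ℤ} (hx : x ≠ 0)
    (hc : IsCoprime (x : GaussianInt) β) :
    quarticJacobiSymbolRat (n / x) β = Jac n β / Jac x β := by
  have hcross : ((n : ℚ) / x).num * x = n * ((n : ℚ) / x).den := by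
    have := Rat.num_div_den ((n : ℚ) / x)
    rw [div_eq_div_iff (by simp) (by exact_mod_cast hx)] at this
    exact_mod_cast this
  have hden : IsCoprime (((n : ℚ) / x).den : GaussianInt) β := by
    refine hc.of_isCoprime_of_dvd_left ?_
    simpa [Rat.divInt_eq_div] using map_dvd (Int.castRingHom GaussianInt) (Rat.den_dvd n x)
  rw [quarticJacobiSymbolRat, div_eq_div_iff (jacobi_ne_zero ho hden) (jacobi_ne_zero ho hc),
    ← jacobi_mul_left ho, ← jacobi_mul_left ho]
  congr 1
  exact_mod_cast congrArg (Int.cast : ℤ → GaussianInt) hcross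

theorem exists_jacobi_eq_I_pow_map_pow {p : ℕ} [Fact p.Prime] {ϖ α : GaussianInt}
    (hN : ϖ.norm = p) (ho : Odd ϖ.norm) (f : GaussianInt →+* ZMod p) (hf : f ϖ = 0)
    (hα : f α ≠ 0) : ∃ k : ℕ, Jac α ϖ = I ^ k ∧ f α ^ ((p - 1) / 4) = f 𝒊 ^ k := by
  have hϖ : Prime ϖ := prime_of_norm_eq_prime Fact.out hN
  have hd : ¬ ϖ ∣ α := mt (map_eq_zero_iff_dvd f hϖ hf).2 hα
  obtain ⟨k, hk, hdvd⟩ := exists_residueSymbol_eq_I_pow hϖ ho hd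
  rw [← map_eq_zero_iff_dvd f hϖ hf, map_sub, map_pow, map_pow, sub_eq_zero, hN,
    Int.natAbs_natCast] at hdvd
  exact ⟨k, (jacobi_prime hϖ α).trans hk, hdvd⟩

namespace TwoRepresentations

variable {p : ℕ} {ϖ : GaussianInt} {x y Q C E X Y q : ℤ}

theorem eq_eight_mul_add_one (h : TwoRepresentations p ϖ x y Q C E X Y q) :
    (p : ℤ) = 8 * (2 * C ^ 2 + C + 2 * E ^ 2) + 1 := by
  rw [← h.norm_eq, norm_eq_sq_add_sq, h.re_eq, h.im_eq]; ring

theorem two_dvd_re_quotient_sub (h : TwoRepresentations p ϖ x y Q C E X Y q) :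
    2 ∣ C - (X + Y) := by
  have h8 := h.eq_eight_mul_add_one
  rw [h.eq_add, h.x_eq, h.y_eq, h.Q_eq] at h8
  obtain ⟨m, hm⟩ := (Int.even_mul_pred_self Y).two_dvd
  exact ⟨X ^ 2 + 2 * q * Y ^ 2 + m - C ^ 2 - E ^ 2, by linarith⟩

theorem intCast_ne_zero (h : TwoRepresentations p ϖ x y Q C E X Y q) {n : ℤ}
    (hn : IsCoprime n p) : (n : ZMod p) ≠ 0 := by
  rwa [Ne, ZMod.intCast_zmod_eq_zero_iff_dvd, ← isCoprime_natCast_iff_not_dvd h.prime]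

theorem two_ne_zero (h : TwoRepresentations p ϖ x y Q C E X Y q) : (2 : ZMod p) ≠ 0 := by
  have : IsCoprime (2 : ℤ) p :=
    ⟨-(4 * (2 * C ^ 2 + C + 2 * E ^ 2)), 1, by rw [h.eq_eight_mul_add_one]; ring⟩
  simpa using h.intCast_ne_zero this

theorem one_add_ne_zero [Fact p.Prime] (h : TwoRepresentations p ϖ x y Q C E X Y q) {w : ZMod p}
    (hw : w ^ 2 = -1) : 1 + w ≠ 0 :=
  fun h0 => h.two_ne_zero (by linear_combination hw - (w - 1) * h0)

theorem neg_Q_eq [Fact p.Prime] (h : TwoRepresentations p ϖ x y Q C E X Y q) {w : ZMod p}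
    (hw : w ^ 2 = -1) : -(Q : ZMod p) = w * (x / (y * (1 + w))) ^ 2 := by
  have hy := h.intCast_ne_zero h.isCoprime_y_p
  have hw1 := h.one_add_ne_zero hw
  have hsum : (x : ZMod p) ^ 2 + 2 * (Q * y ^ 2) = 0 := by
    simpa using (congrArg (Int.cast : ℤ → ZMod p) h.eq_add).symm
  field_simp
  linear_combination (-w) * hsum - Q * y ^ 2 * hw

theorem exists_neg_Q_pow_eq [Fact p.Prime] (h : TwoRepresentations p ϖ x y Q C E X Y q)
    (f : GaussianInt →+* ZMod p) (hf : f ϖ = 0) :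
    ∃ A : ℤ, (-(Q : ZMod p)) ^ ((p - 1) / 8) = f 𝒊 ^ A ∧
      I ^ A * (I ^ (C - E) * Jac y ϖ) = I ^ (2 * C ^ 2 + C + 2 * E ^ 2) * Jac x ϖ := by
  have hw : f 𝒊 ^ 2 = -1 := by rw [← map_pow, sqrtd_sq, map_neg, map_one]
  have hw0 : f 𝒊 ≠ 0 := fun h0 => by simp [h0] at hw
  have hI0 := Complex.I_ne_zero
  have h8 := h.eq_eight_mul_add_one
  obtain ⟨P, hP⟩ : ∃ P : ℕ, (P : ℤ) = 2 * C ^ 2 + C + 2 * E ^ 2 :=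
    Int.eq_ofNat_of_zero_le (by have := h.prime.pos; omega) |>.imp fun _ => Eq.symm
  have hsymbol {α : GaussianInt} (hα : f α ≠ 0) :=
    exists_jacobi_eq_I_pow_map_pow h.norm_eq h.odd_norm f hf hα
  obtain ⟨i, hi, hi'⟩ := hsymbol (α := x) (by simpa using h.intCast_ne_zero h.isCoprime_x_p)
  obtain ⟨j, hj, hj'⟩ := hsymbol (α := y) (by simpa using h.intCast_ne_zero h.isCoprime_y_p)
  obtain ⟨k, hk, hk'⟩ := hsymbol (α := 1 + 𝒊) (by simpa using h.one_add_ne_zero hw)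
  rw [jacobi_one_add_sqrtd h.re_eq h.im_eq h.isCoprime_re_im] at hk
  refine ⟨P + i - (k + j), ?_, ?_⟩
  · simp only [map_intCast, map_add, map_one] at hi' hj' hk'
    rw [h.neg_Q_eq hw, mul_pow, ← pow_mul, show 2 * ((p - 1) / 8) = (p - 1) / 4 by omega, div_pow,
      mul_pow, hi', hj', hk', show (p - 1) / 8 = P by omega, zpow_sub₀ hw0, zpow_add₀ hw0,
      zpow_add₀ hw0, mul_div_assoc, mul_comm (f 𝒊 ^ j)]
    simp only [zpow_natCast]
  · rw [hi, hj, hk, ← hP]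
    simp only [← zpow_natCast, ← zpow_add₀ hI0]
    congr 1; ring

theorem exists_neg_Q_pow_eq_and_jacobi_eq [Fact p.Prime] {β : GaussianInt}
    (h : TwoRepresentations p ϖ x y Q C E X Y q) (f : GaussianInt →+* ZMod p) (hf : f ϖ = 0)
    (hβ : β.norm = Q) :
    ∃ A : ℤ, (-(Q : ZMod p)) ^ ((p - 1) / 8) = f 𝒊 ^ A ∧
      I ^ A * Jac x β = I ^ (2 * (E + Y)) * Jac ϖ β := by
  have hI0 := Complex.I_ne_zero
  obtain ⟨A, hA, hA'⟩ := h.exists_neg_Q_pow_eq f hf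
  refine ⟨A, hA, ?_⟩
  have hN : β.norm = 4 * q + 1 := hβ.trans h.Q_eq
  have hmul := h.jacobi_mul hβ
  rw [jacobi_mul_left (odd_of_eq_four_mul_add_one hN), jacobi_sqrtd hN] at hmul
  have hexp : I ^ q * I ^ (2 * C ^ 2 + C + 2 * E ^ 2) =
      I ^ (2 * (E + Y)) * I ^ (C - E) * I ^ (q + E + 2 * X) := by
    simp only [← zpow_add₀ hI0]
    obtain ⟨n, hn⟩ := h.two_dvd_re_quotient_sub
    obtain ⟨m, hm⟩ := (Int.even_mul_pred_self C).two_dvd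
    obtain ⟨k, hk⟩ := (Int.even_mul_pred_self E).two_dvd
    exact I_zpow_eq_of_modEq (Int.modEq_iff_dvd.2 ⟨-n - m - k, by linarith⟩)
  have hx := jacobi_ne_zero h.odd_norm (h.isCoprime_p h.isCoprime_x_p)
  refine mul_left_cancel₀ (mul_ne_zero (zpow_ne_zero (C - E) hI0)
    (mul_ne_zero (zpow_ne_zero (q + E + 2 * X) hI0) hx)) ?_
  linear_combination I ^ q * Jac ϖ β * hA' - I ^ A * I ^ (C - E) * hmul +
    Jac ϖ β * Jac x ϖ * hexp

end TwoRepresentations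

theorem jacobi_im_mul_re_sub (ho : Odd β.norm) :
    Jac ((β.im * α.re - β.re * α.im : ℤ) : GaussianInt) β = Jac β.im β * Jac α β := by
  rw [← jacobi_mul_left ho]
  refine jacobi_congr ho ⟨-α.im, ?_⟩
  push_cast
  linear_combination (α.im : GaussianInt) * eq_re_add_im_mul_sqrtd β -
    (β.im : GaussianInt) * eq_re_add_im_mul_sqrtd α

theorem exists_normalized_jacobi (k : ℤ) :
    ∃ X : ℤ, (4 * X + 1) ^ 2 = (2 * k + 1) ^ 2 ∧ ∀ {β : GaussianInt} {q : ℤ}, β.norm = 4 * q + 1 →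
      Jac ((4 * X + 1 : ℤ) : GaussianInt) β =
        I ^ (2 * (q * k)) * Jac ((2 * k + 1 : ℤ) : GaussianInt) β := by
  obtain ⟨l, rfl | rfl⟩ := Int.even_or_odd' k
  · refine ⟨l, by ring, fun {β q} _ => ?_⟩
    rw [show 2 * (q * (2 * l)) = 4 * (q * l) by ring, I_zpow_four_mul, one_mul,
      show 2 * (2 * l) + 1 = 4 * l + 1 by ring]
  · refine ⟨-l - 1, by ring, fun {β q} hβ => ?_⟩
    have hq : I ^ (2 * (q * (2 * l + 1))) = (-1) ^ q := by
      rw [neg_one_zpow_eq]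
      exact I_zpow_eq_of_modEq (Int.modEq_iff_dvd.2 ⟨-(q * l), by ring⟩)
    rw [hq, ← jacobi_neg_one hβ, ← jacobi_mul_left (odd_of_eq_four_mul_add_one hβ)]
    congr 1
    push_cast; ring

theorem map_sqrtd_eq {p : ℕ} [Fact p.Prime] (hc : IsCoprime α.re α.im)
    (f : GaussianInt →+* ZMod p) (hf : f α = 0) : f 𝒊 = (α.re : ZMod p) / -α.im := by
  rw [eq_re_add_im_mul_sqrtd α, map_add, map_mul, map_intCast, map_intCast] at hf
  have him : (α.im : ZMod p) ≠ 0 := fun h0 => by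
    rw [h0, zero_mul, add_zero] at hf
    simpa [hf, h0] using hc.map (Int.castRingHom (ZMod p))
  rw [eq_div_iff (neg_ne_zero.2 him)]
  linear_combination -hf

theorem exists_jacobiSymbolRat_eq {p : ℕ} [Fact p.Prime] {ϖ : GaussianInt}
    {x y B l C E k Y : ℤ} (hϖ : ϖ.norm = p) (hp : (p : ℤ) = x ^ 2 + 2 * (β.norm * y ^ 2))
    (hre : ϖ.re = 4 * C + 1) (him : ϖ.im = 4 * E) (hx : x = 2 * k + 1) (hy : y = 2 * Y)
    (hβre : β.re = 2 * B + 1) (hβim : β.im = 2 * l) (hβ : IsCoprime β.re β.im) :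
    (ϖ.re / -ϖ.im : ZMod p) ^ 2 = -1 ∧ (2 : ZMod p) ≠ 0 ∧
      ∃ A : ℤ, (-(β.norm : ZMod p)) ^ ((p - 1) / 8) = (ϖ.re / -ϖ.im : ZMod p) ^ A ∧
        quarticJacobiSymbolRat ((β.im * ϖ.re - β.re * ϖ.im : ℤ) / x) β =
          I ^ (A + l ^ 2 + 2 * (l * (B + k) + Y - E)) := by
  have hI0 := Complex.I_ne_zero
  obtain ⟨X, hX, hJx⟩ := exists_normalized_jacobi k
  have hN : β.norm = 4 * (B ^ 2 + B + l ^ 2) + 1 := by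
    rw [norm_eq_sq_add_sq, hβre, hβim]; ring
  have ho := odd_of_eq_four_mul_add_one hN
  have h : TwoRepresentations p ϖ (4 * X + 1) y β.norm C E X Y (B ^ 2 + B + l ^ 2) :=
    { prime := Fact.out, norm_eq := hϖ, eq_add := by rw [hp, hX, hx], re_eq := hre, im_eq := him,
      x_eq := rfl, y_eq := hy, Q_eq := hN, Q_pos := by
        have := GaussianInt.norm_nonneg β
        omega }
  obtain ⟨f, hf⟩ := exists_hom_zmod hϖ
  obtain ⟨A, hA, hJ⟩ := h.exists_neg_Q_pow_eq_and_jacobi_eq f hf rfl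
  have hw : f 𝒊 ^ 2 = -1 := by rw [← map_pow, sqrtd_sq, map_neg, map_one]
  rw [← map_sqrtd_eq h.isCoprime_re_im f hf]
  refine ⟨hw, h.two_ne_zero, A, hA, ?_⟩
  have hx0 : IsCoprime x β.norm := by
    have := h.isCoprime_x_Q
    rwa [← IsCoprime.pow_left_iff (m := 2) two_pos, hX, ← hx,
      IsCoprime.pow_left_iff two_pos] at this
  have hxβ := isCoprime_of_isCoprime_norm hx0
  rw [jacobiSymbolRat_div ho (by omega) hxβ, div_eq_iff (jacobi_ne_zero ho hxβ),
    jacobi_im_mul_re_sub ho, jacobi_im hβre hβim hβ]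
  rw [hJx hN, ← hx] at hJ
  refine mul_left_cancel₀ (zpow_ne_zero (2 * (E + Y)) hI0) ?_
  obtain ⟨u, hu⟩ := (Int.even_mul_succ_self B).two_dvd
  obtain ⟨v, hv⟩ := (Int.even_mul_pred_self l).two_dvd
  have hexp : I ^ (2 * (E + Y)) * I ^ (A + l ^ 2 + 2 * (l * (B + k) + Y - E)) =
      I ^ A * I ^ (2 * ((B ^ 2 + B + l ^ 2) * k)) * I ^ (l ^ 2 + 2 * (B * l)) := by
    simp only [← zpow_add₀ hI0]
    exact I_zpow_eq_of_modEq (Int.modEq_iff_dvd.2 ⟨u * k + v * k - Y, by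
      linear_combination 2 * k * hu + 2 * k * hv⟩)
  linear_combination -I ^ (l ^ 2 + 2 * (B * l)) * hJ - Jac x β * hexp

theorem exists_pow_eq_zpow_and_jacobiSymbolRat_eq {p : ℕ} [Fact p.Prime]
    {a b c d x y l B C D k Y : ℤ} (hcd : (p : ℤ) = c ^ 2 + d ^ 2)
    (hxy : (p : ℤ) = x ^ 2 + 2 * (a ^ 2 + b ^ 2) * y ^ 2) (hab : Int.gcd a b = 1)
    (ha : a = 2 * l) (hb : b = 2 * B + 1) (hc : c = 4 * C + 1) (hd : d = 4 * D)
    (hx : x = 2 * k + 1) (hy : y = 2 * Y) :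
    ((c : ZMod p) / d) ^ 2 = -1 ∧ (2 : ZMod p) ≠ 0 ∧
      ∃ A : ℤ, (-(a : ZMod p) ^ 2 - (b : ZMod p) ^ 2) ^ ((p - 1) / 8) = ((c : ZMod p) / d) ^ A ∧
        quarticJacobiSymbolRat ((a * c + b * d : ℚ) / x) ⟨b, a⟩ =
          I ^ (A + l ^ 2 + 2 * (l * (B + k) + Y + D)) := by
  have key := exists_jacobiSymbolRat_eq (p := p) (β := ⟨b, a⟩) (ϖ := ⟨c, -d⟩) (E := -D)
    (by rw [norm_eq_sq_add_sq, hcd]; ring) (by rw [norm_eq_sq_add_sq, hxy]; ring) hc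
    (by rw [hd]; ring) hx hy hb ha (Int.isCoprime_iff_gcd_eq_one.2 hab).symm
  have hnorm : -((⟨b, a⟩ : GaussianInt).norm : ZMod p) = -(a : ZMod p) ^ 2 - (b : ZMod p) ^ 2 := by
    rw [norm_eq_sq_add_sq]; push_cast; ring
  have hnum : ((a * c - b * -d : ℤ) : ℚ) = a * c + b * d := by push_cast; ring
  simpa only [hnorm, hnum, Int.cast_neg, neg_neg, sub_neg_eq_add] using key

theorem eq_neg_one_zpow_mul_zpow_iff {K : Type*} [Field K] {w g : K} (hw : w ^ 2 = -1)
    (h2 : (2 : K) ≠ 0) {R : ℂ} {A n N T m : ℤ} (hg : g = w ^ A) (hR : R = I ^ n)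
    (h : n + (2 * N + T) ≡ A + m [ZMOD 4]) : g = (-1) ^ N * w ^ T ↔ R = I ^ m := by
  have hw0 : w ≠ 0 := by rintro rfl; simp at hw
  have hsign : (-1 : K) ^ N * w ^ T = w ^ (2 * N + T) := by
    rw [zpow_add₀ hw0, zpow_mul, zpow_ofNat, hw]
  rw [hg, hR, hsign, zpow_eq_zpow_iff_modEq_four hw h2,
    zpow_eq_zpow_iff_modEq_four Complex.I_sq two_ne_zero]
  simp only [Int.modEq_iff_dvd] at h ⊢
  omega

theorem four_dvd_of_eq_sq_add_sq {c d e : ℤ} (hc : Odd c) (h : 8 * e + 1 = c ^ 2 + d ^ 2) :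
    4 ∣ d := by
  have hd : 8 ∣ d ^ 2 := by
    have := Int.eight_dvd_sq_sub_one_of_odd hc
    omega
  obtain ⟨k, rfl⟩ := Int.prime_two.dvd_of_dvd_pow ((by norm_num : (2 : ℤ) ∣ 8).trans hd)
  have hk : 2 ∣ k ^ 2 := by rw [mul_pow] at hd; omega
  exact mul_dvd_mul_left 2 (Int.prime_two.dvd_of_dvd_pow hk)

theorem odd_of_eq_sq_add_two_mul {x Q y e : ℤ} (h : 8 * e + 1 = x ^ 2 + 2 * Q * y ^ 2) : Odd x := by
  refine Int.odd_pow' two_ne_zero |>.1 ⟨4 * e - Q * y ^ 2, ?_⟩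
  linear_combination -h

theorem even_of_eq_sq_add_two_mul {x Q y e : ℤ} (hx : Odd x) (hQ : Odd Q)
    (h : 8 * e + 1 = x ^ 2 + 2 * Q * y ^ 2) : Even y := by
  have hdvd : 4 ∣ Q * y ^ 2 := by
    have := Int.eight_dvd_sq_sub_one_of_odd hx
    rw [mul_assoc] at h
    omega
  have : Even (Q * y ^ 2) := even_iff_two_dvd.2 ((by norm_num : (2 : ℤ) ∣ 4).trans hdvd)
  simpa [Int.even_mul, Int.not_even_iff_odd.2 hQ, Int.even_pow] using this

theorem exists_parametrization {p : ℕ} {a b c d x y : ℤ} (hp : p ≡ 1 [MOD 8])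
    (hcd : (p : ℤ) = c ^ 2 + d ^ 2) (hxy : (p : ℤ) = x ^ 2 + 2 * (a ^ 2 + b ^ 2) * y ^ 2)
    (ha2 : 2 ∣ a) (hab : Int.gcd a b = 1) (hc : c ≡ 1 [ZMOD 4]) :
    ∃ l B C D k Y : ℤ, a = 2 * l ∧ b = 2 * B + 1 ∧ c = 4 * C + 1 ∧ d = 4 * D ∧ x = 2 * k + 1 ∧
      y = 2 * Y := by
  obtain ⟨e, he⟩ : ∃ e : ℤ, (p : ℤ) = 8 * e + 1 := ⟨p / 8, by
    have : p % 8 = 1 := hp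
    omega⟩
  obtain ⟨l, rfl⟩ := ha2
  obtain ⟨B, rfl⟩ : Odd b := by
    rw [← Int.not_even_iff_odd, even_iff_two_dvd]
    exact fun hb => Int.prime_two.not_isUnit
      ((Int.isCoprime_iff_gcd_eq_one.2 hab).isUnit_of_dvd' (dvd_mul_right 2 l) hb)
  obtain ⟨k, rfl⟩ := odd_of_eq_sq_add_two_mul (he.symm.trans hxy)
  obtain ⟨C, rfl⟩ : ∃ C, c = 4 * C + 1 := ⟨c / 4, by have : c % 4 = 1 := hc; omega⟩
  obtain ⟨D, rfl⟩ := four_dvd_of_eq_sq_add_sq ⟨2 * C, by ring⟩ (he.symm.trans hcd)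
  obtain ⟨Y, rfl⟩ := (even_of_eq_sq_add_two_mul ⟨k, rfl⟩ ⟨2 * (l ^ 2 + B ^ 2 + B), by ring⟩
    (he.symm.trans hxy)).two_dvd
  exact ⟨l, B, C, D, k, Y, rfl, rfl, rfl, rfl, rfl, rfl⟩

end Comparison

end QuarticSymbol

open QuarticSymbol in
theorem theorem4p7_general (p : ℕ) [Fact p.Prime] (hp : p ≡ 1 [MOD 8])
    (a b c d x y : ℤ) (hcd : (p : ℤ) = c ^ 2 + d ^ 2)
    (hxy : (p : ℤ) = x ^ 2 + 2 * (a ^ 2 + b ^ 2) * y ^ 2)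
    (ha2 : 2 ∣ a) (hab : Int.gcd a b = 1) (hc : c ≡ 1 [ZMOD 4]) (m : ℤ) :
    (4 ∣ a →
      ((-(a : ZMod p) ^ 2 - (b : ZMod p) ^ 2) ^ ((p - 1) / 8) =
          (-1) ^ (d / 4 + y / 2) * ((c : ZMod p) / (d : ZMod p)) ^ m ↔
        quarticJacobiSymbolRat ((a * c + b * d : ℚ) / x) ⟨b, a⟩ = Complex.I ^ m)) ∧
    (4 ∣ a - 2 →
      ((-(a : ZMod p) ^ 2 - (b : ZMod p) ^ 2) ^ ((p - 1) / 8) =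
          (-1) ^ ((b - 1) / 2 + d / 4 + y / 2 + (x - 1) / 2) *
            ((c : ZMod p) / (d : ZMod p)) ^ (m - 1) ↔
        quarticJacobiSymbolRat ((a * c + b * d : ℚ) / x) ⟨b, a⟩ = Complex.I ^ m)) := by
  obtain ⟨l, B, C, D, k, Y, ha, hb, hc, hd, hx, hy⟩ := exists_parametrization hp hcd hxy ha2 hab hc
  obtain ⟨hw, h2, A, hA, hR⟩ :=
    exists_pow_eq_zpow_and_jacobiSymbolRat_eq hcd hxy hab ha hb hc hd hx hy
  rw [show d / 4 = D by omega, show y / 2 = Y by omega, show (b - 1) / 2 = B by omega,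
    show (x - 1) / 2 = k by omega]
  refine ⟨fun h4 => eq_neg_one_zpow_mul_zpow_iff hw h2 hA hR ?_,
    fun h4 => eq_neg_one_zpow_mul_zpow_iff hw h2 hA hR ?_⟩
  · obtain ⟨n, rfl⟩ : 2 ∣ l := by omega
    exact Int.modEq_iff_dvd.2 ⟨-(n ^ 2 + n * (B + k) + Y + D), by ring⟩
  · obtain ⟨n, rfl⟩ : ∃ n, l = 2 * n + 1 := ⟨l / 2, by omega⟩
    exact Int.modEq_iff_dvd.2 ⟨-(n ^ 2 + n + (n + 1) * (B + k) + Y + D), by ring⟩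

theorem theorem4p7 (p : ℕ) [Fact p.Prime] (hp : p ≡ 1 [MOD 8])
    (a b c d x y : ℤ) (hcd : (p : ℤ) = c ^ 2 + d ^ 2)
    (hxy : (p : ℤ) = x ^ 2 + 2 * (a ^ 2 + b ^ 2) * y ^ 2)
    (ha0 : a ≠ 0) (ha2 : 2 ∣ a) (hab : Int.gcd a b = 1)
    (hc : c ≡ 1 [ZMOD 4])
    (r : ℕ) (d₀ : ℤ) (hd : d = 2 ^ r * d₀) (hd₀ : d₀ ≡ 1 [ZMOD 4])
    (hgcd : Int.gcd c (x + d) = 1 ∨ Int.gcd d₀ (x + c) = 1) (m : ℤ) :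
    (4 ∣ a →
      ((-(a : ZMod p) ^ 2 - (b : ZMod p) ^ 2) ^ ((p - 1) / 8) =
          (-1) ^ (d / 4 + y / 2) * ((c : ZMod p) / (d : ZMod p)) ^ m ↔
        quarticJacobiSymbolRat ((a * c + b * d : ℚ) / x) ⟨b, a⟩ = Complex.I ^ m)) ∧
    (4 ∣ a - 2 →
      ((-(a : ZMod p) ^ 2 - (b : ZMod p) ^ 2) ^ ((p - 1) / 8) =
          (-1) ^ ((b - 1) / 2 + d / 4 + y / 2 + (x - 1) / 2) *
            ((c : ZMod p) / (d : ZMod p)) ^ (m - 1) ↔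
        quarticJacobiSymbolRat ((a * c + b * d : ℚ) / x) ⟨b, a⟩ = Complex.I ^ m)) :=
  theorem4p7_general p hp a b c d x y hcd hxy ha2 hab hc m
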